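/- **Model.** Time is slotted, with slots of length $\Delta$. A task is a finite non-empty list $h=(h_1,\dots,h_K)$ of indices of contents from $\{F_1,\dots,F_N\}$ (repetitions allowed), each content having size $\tau$; the contents $F_1,\dots,F_M$ are cached at the mobile device. Tasks are i.i.d. with an arbitrary law such that $\mathbb E[K^2]<\infty$. The transmission data of a task is $D_{ct}=\tau K$ in MEC mode and $D_{lt}=\tau\cdot\#\{n>M: n\in\{h_1,\dots,h_K\}\}$ in local mode. It occupies the MEC server for $N_c=\lceil \tau K W/(f_c\Delta)+D_{ct}/(R\Delta)\rceil$ slots in MEC mode, and the mobile device for $N_l=\lceil \tau K W/(f_l\Delta)+D_{lt}/(R\Delta)\rceil$ slots in local mode. Here $\tau,\Delta,W,f_c,f_l,R>0$. Write $\bar D_{ct},\bar D_{lt},\bar N_c,\bar N_l$ for the expectations. In slot $t=0,1,2,\dots$ a task arrives with probability $\lambda\in(0,1]$, independently of everything else ($A(t)\in\{0,1\}$). A decision $u(t)=(u_l^1,u_l^2,u_c^1,u_c^2)(t)$ is one of $(0,0,0,0)$, $(1,0,0,0)$, $(0,0,1,0)$, $(1,0,0,1)$, $(0,1,1,0)$,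 where $u_l^i=1$ (resp. $u_c^i=1$) starts the $i$-th task of the slot on the mobile device (resp. the MEC server). With $Q(0)=S_l(0)=S_c(0)=0$, $$Q(t+1)=\bigl(Q(t)-u_l^1(t)-u_l^2(t)-u_c^1(t)-u_c^2(t)\bigr)^++A(t),$$ and $S_l(t+1)=N_l^i(t)-1$ if $u_l^i(t)=1$ for some $i$, and $S_l(t+1)=\max(S_l(t)-1,0)$ otherwise; likewise for $S_c$ with $u_c^i,N_c^i$. A decision may start a task only on an idle device ($S_l(t)=0$, resp. $S_c(t)=0$) and may start at most $Q(t)$ tasks; if it starts exactly one task, this is the first one. A policy chooses $u(t)$ (possibly at random) from the past before slot $t$, in particular from $Q,S_l,S_c$ up to time $t$, without knowing the contents of the tasks that have not been started. **Problem P1.** Minimize $$\limsup_{T\to\infty}\frac1{\lambda T}\,\mathbb E\Bigl[\sum_{t=0}^{T-1}\sum_{i=1}^{2}\bigl(u_l^i(t)D_{lt}^i(t)+u_c^i(t)D_{ct}^i(t)\bigr)\Bigr]$$ over the policies with $\limsup_{T\to\infty}\frac1T\mathbb E\bigl[\sum_{t=0}^{T-1}Q(t)\bigr]<\infty$ (the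 feasible ones). Let $\bar D^{Opt}$ be the optimal value, i.e. the infimum. **Proposition.** 1. If $\lambda\le \frac1{\bar N_l}$, then P1 is feasible and $\bar D^{Opt}=\bar D_{lt}$. 2. If $\frac1{\bar N_l}<\lambda<\frac1{\bar N_l}+\frac1{\bar N_c}$, then P1 is feasible and $\bar D^{Opt}=\bar D_{ct}-\frac{1}{\lambda\bar N_l}(\bar D_{ct}-\bar D_{lt})$. 3. If $\lambda=\frac1{\bar N_l}+\frac1{\bar N_c}$, then $\bar D^{Opt}$ is given by the formula of part 2 whenever P1 is feasible; but P1 is infeasible if $\lambda<1$. 4. If $\lambda>\frac1{\bar N_l}+\frac1{\bar N_c}$, then P1 is infeasible. -/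

import Mathlib

open MeasureTheory ProbabilityTheory Filter
open scoped ENNReal unitInterval

noncomputable section

namespace MEC

/-- A task is the vector `[h₁, …, h_K]` of the indices of its contents (with repetitions allowed);
the contents `F₁, …, F_N` are indexed by `Fin N`. -/
abbrev Task (N : ℕ) : Type := List (Fin N)

instance (N : ℕ) : MeasurableSpace (Task N) := ⊤

/-- The parameters of the system. -/
structure System where
  /-- number of contents -/
  N : ℕ
  /-- cache capacity of the mobile device: the first `M` contents are cached -/
  M : ℕ
  /-- size of one content -/
  τ : ℝ
  /-- length of a time slot -/
  Δ : ℝ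
  /-- CPU cycles for one bit -/
  W : ℝ
  /-- CPU frequency of the MEC server -/
  fc : ℝ
  /-- CPU frequency of the mobile device -/
  fl : ℝ
  /-- wireless throughput -/
  R : ℝ
  /-- arrival probability in a slot -/
  lam : I
  /-- the law of a task: arbitrary, subject to the last two fields; in particular the contents may
  be drawn independently from a popularity distribution, with a random number of contents -/
  taskLaw : Measure (Task N)
  τ_pos : 0 < τ
  Δ_pos : 0 < Δ
  W_pos : 0 < W
  fc_pos : 0 < fc
  fl_pos : 0 < fl
  R_pos : 0 < R
  lam_pos : 0 < lam
  isProbabilityMeasure_taskLaw : IsProbabilityMeasure taskLaw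
  /-- a task has at least one content -/
  ae_ne_nil : ∀ᵐ h ∂taskLaw, h ≠ []
  /-- the number of contents of a task has a finite second moment -/
  integrable_sq : Integrable (fun h => (h.length : ℝ) ^ 2) taskLaw

namespace System

variable (sys : System)

/-- The size `D = τ K` of a task. -/
def D (h : Task sys.N) : ℝ := sys.τ * h.length

/-- Indicator of the event that a content is requested by the task and is not cached. -/
def G (h : Task sys.N) (n : Fin sys.N) : ℝ := if sys.M ≤ n.val ∧ n ∈ h then 1 else 0

/-- Transmission data in MEC mode. -/
def Dct (h : Task sys.N) : ℝ := sys.D h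

/-- Computation data in MEC mode. -/
def Dcc (h : Task sys.N) : ℝ := sys.D h

/-- Transmission data in local mode. -/
def Dlt (h : Task sys.N) : ℝ := sys.τ * ∑ n, sys.G h n

/-- Computation data in local mode. -/
def Dlc (h : Task sys.N) : ℝ := sys.D h

/-- Number of slots needed in MEC mode. -/
def Nc (h : Task sys.N) : ℕ :=
  ⌈sys.Dcc h * sys.W / (sys.fc * sys.Δ) + sys.Dct h / (sys.R * sys.Δ)⌉₊

/-- Number of slots needed in local mode. -/
def Nl (h : Task sys.N) : ℕ :=
  ⌈sys.Dlc h * sys.W / (sys.fl * sys.Δ) + sys.Dlt h / (sys.R * sys.Δ)⌉₊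

/-- `E[D_ct]` -/
def meanDct : ℝ := ∫ h, sys.Dct h ∂sys.taskLaw

/-- `E[D_lt]` -/
def meanDlt : ℝ := ∫ h, sys.Dlt h ∂sys.taskLaw

/-- `E[N_c]` -/
def meanNc : ℝ := ∫ h, (sys.Nc h : ℝ) ∂sys.taskLaw

/-- `E[N_l]` -/
def meanNl : ℝ := ∫ h, (sys.Nl h : ℝ) ∂sys.taskLaw

end System

/-- A scheduling decision `(u_l¹, u_l², u_c¹, u_c²)`; there are five of them. -/
inductive Decision
  /-- `(0,0,0,0)` -/
  | none
  /-- `(1,0,0,0)` -/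
  | loc
  /-- `(0,0,1,0)` -/
  | mec
  /-- `(1,0,0,1)` -/
  | locMec
  /-- `(0,1,1,0)` -/
  | mecLoc

instance : MeasurableSpace Decision := ⊤

namespace Decision

/-- The first task of the slot is started on the mobile device. -/
def ul1 : Decision → ℕ
  | loc | locMec => 1
  | _ => 0

/-- The second task of the slot is started on the mobile device. -/
def ul2 : Decision → ℕ
  | mecLoc => 1
  | _ => 0

/-- The first task of the slot is started on the MEC server. -/
def uc1 : Decision → ℕ
  | mec | mecLoc => 1
  | _ => 0

/-- The second task of the slot is started on the MEC server. -/
def uc2 : Decision → ℕ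
  | locMec => 1
  | _ => 0

end Decision

/-- The state `(Q, S_l, S_c)`: the queue length and the numbers of slots during which the mobile
device and the MEC server remain busy. -/
structure State where
  Q : ℕ
  Sl : ℕ
  Sc : ℕ

/-- The decisions that are available in a state. -/
def State.allowed (s : State) : Set Decision :=
  if s.Q = 0 ∨ (s.Sl ≠ 0 ∧ s.Sc ≠ 0) then {.none}
  else if s.Sl ≠ 0 then {.none, .mec}
  else if s.Sc ≠ 0 then {.none, .loc}
  else if s.Q = 1 then {.none, .mec, .loc}
  else Set.univ

/-- What chance supplies in one slot: the number of arrivals `A(t) ∈ {0, 1}`, the first and the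
second task that can be scheduled in this slot, and a uniform variable on which the scheduler
may base a randomized decision. -/
structure Slot (N : ℕ) where
  A : ℕ
  task1 : Task N
  task2 : Task N
  seed : I

/-- A slot as a quadruple. -/
def Slot.toProd {N : ℕ} (x : Slot N) : ℕ × Task N × Task N × I :=
  (x.A, x.task1, x.task2, x.seed)

/-- A quadruple as a slot. -/
def Slot.ofProd {N : ℕ} (x : ℕ × Task N × Task N × I) : Slot N :=
  ⟨x.1, x.2.1, x.2.2.1, x.2.2.2⟩

instance (N : ℕ) : MeasurableSpace (Slot N) := MeasurableSpace.comap Slot.toProd inferInstance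

namespace System

variable (sys : System)

/-- The law of one slot: a Bernoulli arrival, two tasks and a uniform seed, all independent. -/
def slotLaw : Measure (Slot sys.N) :=
  ((bernoulliMeasure (1 : ℕ) 0 sys.lam).prod
    (sys.taskLaw.prod (sys.taskLaw.prod (volume : Measure I)))).map Slot.ofProd

instance : IsProbabilityMeasure sys.slotLaw := by
  have := sys.isProbabilityMeasure_taskLaw
  have h : Measurable (Slot.ofProd (N := sys.N)) :=
    measurable_comap_iff.mpr (measurable_id : Measurable fun x : ℕ × Task sys.N × Task sys.N × I => x)
  exact Measure.isProbabilityMeasure_map h.aemeasurable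

/-- Sample paths. -/
abbrev Path : Type := ℕ → Slot sys.N

/-- The slots are independent and identically distributed. -/
def P : Measure sys.Path := Measure.infinitePi fun _ => sys.slotLaw

/-- What the scheduler may use at time `t`: everything that happened in the slots `0, …, t - 1`
(so in particular `Q`, `S_l`, `S_c` up to time `t`), and the current seed. The contents of tasks
that have not been started are not part of it. -/
@[reducible] def info (t : ℕ) : MeasurableSpace sys.Path :=
  (⨆ s : Fin t, MeasurableSpace.comap (fun ω : sys.Path => ω s) inferInstance) ⊔
    MeasurableSpace.comap (fun ω : sys.Path => (ω t).seed) inferInstance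

/-- One step of the dynamics. -/
def next (s : State) (u : Decision) (x : Slot sys.N) : State where
  Q := s.Q - (u.ul1 + u.ul2 + u.uc1 + u.uc2) + x.A
  Sl := if u.ul1 = 1 then sys.Nl x.task1 - 1
    else if u.ul2 = 1 then sys.Nl x.task2 - 1
    else s.Sl - 1
  Sc := if u.uc1 = 1 then sys.Nc x.task1 - 1
    else if u.uc2 = 1 then sys.Nc x.task2 - 1
    else s.Sc - 1

/-- The state at time `t` under the decisions `π`; the system starts empty. -/
def state (π : ℕ → sys.Path → Decision) (ω : sys.Path) : ℕ → State
  | 0 => ⟨0, 0, 0⟩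
  | t + 1 => sys.next (state π ω t) (π t ω) (ω t)

/-- A scheduling policy: non-anticipating decisions, each available in the current state. -/
structure Policy where
  act : ℕ → sys.Path → Decision
  measurable_act : ∀ t, Measurable[sys.info t] (act t)
  act_mem : ∀ t ω, act t ω ∈ (sys.state act ω t).allowed

variable {sys}

/-- The data transmitted for the tasks that are scheduled in slot `t`. -/
def Policy.data (π : sys.Policy) (t : ℕ) (ω : sys.Path) : ℝ :=
  (π.act t ω).ul1 * sys.Dlt (ω t).task1 + (π.act t ω).uc1 * sys.Dct (ω t).task1 +
    ((π.act t ω).ul2 * sys.Dlt (ω t).task2 + (π.act t ω).uc2 * sys.Dct (ω t).task2)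

/-- The average transmission data per task. -/
def Policy.avgData (π : sys.Policy) : ℝ≥0∞ :=
  limsup (fun T : ℕ => (∫⁻ ω, ENNReal.ofReal (∑ t ∈ Finset.range T, π.data t ω) ∂sys.P) /
    ENNReal.ofReal ((sys.lam : ℝ) * T)) atTop

/-- The average queue length. -/
def Policy.avgQueue (π : sys.Policy) : ℝ≥0∞ :=
  limsup (fun T : ℕ => (∫⁻ ω, ∑ t ∈ Finset.range T, ((sys.state π.act ω t).Q : ℝ≥0∞) ∂sys.P) /
    (T : ℝ≥0∞)) atTop

variable (sys)

/-- The feasible policies: those that satisfy the delay constraint. -/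
def feasible : Set sys.Policy := {π | π.avgQueue < ⊤}

/-- The optimal value: the infimum of the average transmission data per task over the feasible
policies (`⊤` if there is none). -/
def optData : ℝ≥0∞ := ⨅ π ∈ sys.feasible, π.avgData

end System

end MEC

end

/-!
Each device is a server: the expected residual work of the task being served is sublinear in `T`,
so a device with mean service time `m` starts tasks at an asymptotic rate of at most `1 / m`.
A task that has arrived is either started or still queued, and for a feasible policy
`𝔼 Q(T) / T → 0` along a subsequence. Along it the two start rates add up to `λ`, which bounds `λ`
by the sum of the maximal rates and the transmission data from below.

When `λ` equals that sum, and `m_l`, `m_c` are the mean service times of the two devices, the load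
`Q + S_l / m_l + S_c / m_c` of a feasible policy is an `L¹`-bounded submartingale, hence convergent,
so its increments tend to `0`. But an increment is the sum of the arrival indicator of the slot,
which is not constant when `λ < 1`, and of a term independent of it, so it stays away from `0` with
a fixed probability.

For `λ` below the sum, send every arriving task to a random device and let each device serve its
own queue. When both devices have load less than one, the squared workload of a queue is a Lyapunov
function, so the policy is feasible, and its data is that of the chosen routing probabilities;
probabilities that load a device fully are limits of such.
-/

noncomputable section

namespace MEC

section PiSystem

variable {Ω : Type*} (m₁ m₂ : MeasurableSpace Ω)

lemma isPiSystem_inter :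
    IsPiSystem (Set.image2 (· ∩ ·) {s | MeasurableSet[m₁] s} {s | MeasurableSet[m₂] s}) := by
  rintro _ ⟨a, ha, b, hb, rfl⟩ _ ⟨a', ha', b', hb', rfl⟩ -
  exact ⟨a ∩ a', ha.inter ha', b ∩ b', hb.inter hb', Set.inter_inter_inter_comm ..⟩

lemma sup_eq_generateFrom_inter : m₁ ⊔ m₂ = MeasurableSpace.generateFrom
    (Set.image2 (· ∩ ·) {s | MeasurableSet[m₁] s} {s | MeasurableSet[m₂] s}) := by
  apply le_antisymm
  · refine sup_le (fun a ha => ?_) (fun b hb => ?_) <;>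
      refine MeasurableSpace.measurableSet_generateFrom ?_
    · exact ⟨a, ha, Set.univ, .univ, Set.inter_univ a⟩
    · exact ⟨Set.univ, .univ, b, hb, Set.univ_inter b⟩
  · refine MeasurableSpace.generateFrom_le ?_
    rintro _ ⟨a, ha, b, hb, rfl⟩
    exact .inter ((le_sup_left : m₁ ≤ m₁ ⊔ m₂) a ha) ((le_sup_right : m₂ ≤ m₁ ⊔ m₂) b hb)

end PiSystem

section Fresh

variable {Ω β γ : Type*} {m m' mΩ : MeasurableSpace Ω} {mγ : MeasurableSpace γ}
  {m₁ mβ : MeasurableSpace β} {μ : Measure Ω} {ν : Measure β} {ρ : Measure γ}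
  {X Y : Ω → β} {Z : β → γ} {g : Ω → ℝ} {f : β → ℝ}

/-- A fresh sample: a random element `X` of law `ν` that is independent of the past, which is
described by the σ-algebra `m`. The product formula expresses both requirements at once. -/
structure IsFresh (m : MeasurableSpace Ω) {mΩ : MeasurableSpace Ω} (μ : Measure Ω) (X : Ω → β)
    (ν : Measure β) : Prop where
  measurable : Measurable X
  measure_inter_preimage : ∀ s, MeasurableSet[m] s → ∀ t, MeasurableSet t →
    μ (s ∩ X ⁻¹' t) = μ s * ν t

namespace IsFresh

lemma mono (h : IsFresh m μ X ν) (hm : m' ≤ m) : IsFresh m' μ X ν where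
  measurable := h.measurable
  measure_inter_preimage s hs := h.measure_inter_preimage s (hm s hs)

lemma comp (h : IsFresh m μ X ν) (hZ : Measurable Z) : IsFresh m μ (Z ∘ X) (ν.map Z) where
  measurable := hZ.comp h.measurable
  measure_inter_preimage s hs t ht := by
    rw [Measure.map_apply hZ ht, ← h.measure_inter_preimage s hs _ (hZ ht), Set.preimage_comp]

lemma ite (hX : IsFresh m μ X ν) (hY : IsFresh m μ Y ν) (hm : m ≤ mΩ) {p : Ω → Prop}
    [DecidablePred p] (hp : MeasurableSet[m] {ω | p ω}) :
    IsFresh m μ (fun ω => if p ω then X ω else Y ω) ν where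
  measurable := .ite (hm _ hp) hX.measurable hY.measurable
  measure_inter_preimage s hs t ht := by
    rw [← measure_inter_add_sdiff _ (hm _ hp), ← measure_inter_add_sdiff s (hm _ hp), add_mul,
      ← hX.measure_inter_preimage _ (hs.inter hp) t ht,
      ← hY.measure_inter_preimage _ (hs.diff hp) t ht]
    congr 2 <;> ext ω <;> by_cases h : p ω <;> simp [h]

lemma fst_prod (ν : Measure β) [IsProbabilityMeasure ν] (ρ : Measure γ) [SFinite ρ] :
    IsFresh (mγ.comap Prod.snd) (ν.prod ρ) Prod.fst ν where
  measurable := measurable_fst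
  measure_inter_preimage := by
    rintro _ ⟨s, -, rfl⟩ t -
    rw [Set.inter_comm, ← Set.prod_eq, Measure.prod_prod, ← Set.univ_prod, Measure.prod_prod,
      measure_univ, one_mul, mul_comm]

lemma comap (hZ : IsFresh m₁ ν Z ρ) (hX : MeasurePreserving X μ ν) (hm₁ : m₁ ≤ mβ) :
    IsFresh (m₁.comap X) μ (Z ∘ X) ρ where
  measurable := hZ.measurable.comp hX.measurable
  measure_inter_preimage := by
    rintro _ ⟨b, hb, rfl⟩ t ht
    rw [Set.preimage_comp, ← Set.preimage_inter, hX.measure_preimage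
      ((hm₁ b hb).inter (hZ.measurable ht)).nullMeasurableSet,
      hX.measure_preimage (hm₁ b hb).nullMeasurableSet, hZ.measure_inter_preimage b hb t ht]

lemma of_indep (hm : Indep m (mβ.comap X) μ) (hX : MeasurePreserving X μ ν) :
    IsFresh m μ X ν where
  measurable := hX.measurable
  measure_inter_preimage s hs t ht := by
    rw [(Indep_iff ..).1 hm s _ hs ⟨t, ht, rfl⟩, hX.measure_preimage ht.nullMeasurableSet]

variable [IsProbabilityMeasure μ]

lemma measurePreserving (h : IsFresh m μ X ν) : MeasurePreserving X μ ν where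
  measurable := h.measurable
  map_eq := Measure.ext fun t ht => by
    rw [Measure.map_apply h.measurable ht]
    simpa using h.measure_inter_preimage Set.univ (@MeasurableSet.univ _ m) t ht

lemma isProbabilityMeasure (h : IsFresh m μ X ν) : IsProbabilityMeasure ν := by
  rw [← h.measurePreserving.map_eq]
  exact Measure.isProbabilityMeasure_map h.measurable.aemeasurable

lemma indep (h : IsFresh m μ X ν) : Indep m (mβ.comap X) μ := by
  rw [Indep_iff]
  rintro s _ hs ⟨t, ht, rfl⟩
  rw [h.measure_inter_preimage s hs t ht,
    h.measurePreserving.measure_preimage ht.nullMeasurableSet]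

lemma nested [IsProbabilityMeasure ν] (hX : IsFresh m μ X ν) (hZ : IsFresh m₁ ν Z ρ)
    (hm : m ≤ mΩ) (hm₁ : m₁ ≤ mβ) : IsFresh (m ⊔ m₁.comap X) μ (Z ∘ X) ρ := by
  refine .of_indep ?_ (hZ.measurePreserving.comp hX.measurePreserving)
  refine IndepSets.indep (sup_le hm (hX.measurable.mono le_rfl hm₁).comap_le)
    (hZ.measurable.comp hX.measurable).comap_le (isPiSystem_inter m (m₁.comap X))
    (@MeasurableSpace.isPiSystem_measurableSet _ (mγ.comap (Z ∘ X)))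
    (sup_eq_generateFrom_inter m (m₁.comap X))
    (@MeasurableSpace.generateFrom_measurableSet _ (mγ.comap (Z ∘ X))).symm
    ((IndepSets_iff ..).2 ?_)
  rintro _ _ ⟨a, ha, _, ⟨b, hb, rfl⟩, rfl⟩ ⟨t, ht, rfl⟩
  rw [Set.inter_assoc, Set.preimage_comp, ← Set.preimage_inter,
      hX.measure_inter_preimage a ha b (hm₁ b hb),
      hX.measure_inter_preimage a ha _ ((hm₁ b hb).inter (hZ.measurable ht)),
      hZ.measure_inter_preimage b hb t ht,
      hX.measurePreserving.measure_preimage (hZ.measurable ht).nullMeasurableSet,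
      hZ.measurePreserving.measure_preimage ht.nullMeasurableSet, mul_assoc]

lemma indepFun (h : IsFresh m μ X ν) (hg : Measurable[m] g) (hf : Measurable f) :
    IndepFun g (f ∘ X) μ :=
  (IndepFun_iff_Indep ..).2 <|
    indep_of_indep_of_le h.indep hg.comap_le (hf.comp (comap_measurable X)).comap_le

lemma integral_comp (h : IsFresh m μ X ν) (hf : Measurable f) :
    ∫ ω, f (X ω) ∂μ = ∫ x, f x ∂ν := by
  rw [← h.measurePreserving.map_eq,
    integral_map h.measurable.aemeasurable hf.aestronglyMeasurable]

lemma integral_mul (h : IsFresh m μ X ν) (hm : m ≤ mΩ) (hg : Measurable[m] g)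
    (hf : Measurable f) :
    ∫ ω, g ω * f (X ω) ∂μ = (∫ ω, g ω ∂μ) * ∫ x, f x ∂ν := by
  rw [← h.integral_comp hf]
  exact (h.indepFun hg hf).integral_fun_mul_eq_mul_integral
    (hg.mono hm le_rfl).aestronglyMeasurable (hf.comp h.measurable).aestronglyMeasurable

lemma setIntegral_mul_sub_integral (h : IsFresh m μ X ν) (hm : m ≤ mΩ) (hg : Measurable[m] g)
    (hf : Measurable f) (hfi : Integrable f ν) {s : Set Ω} (hs : MeasurableSet[m] s) :
    ∫ ω in s, g ω * (f (X ω) - ∫ x, f x ∂ν) ∂μ = 0 := by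
  have := h.isProbabilityMeasure
  calc ∫ ω in s, g ω * (f (X ω) - ∫ x, f x ∂ν) ∂μ
      = ∫ ω, s.indicator g ω * (f (X ω) - ∫ x, f x ∂ν) ∂μ := by
        rw [← integral_indicator (hm _ hs)]
        simp only [Set.indicator_mul_left]
    _ = 0 := by
        rw [h.integral_mul hm (hg.indicator hs) (f := fun x => f x - ∫ x, f x ∂ν)
          (hf.sub_const _), integral_sub hfi (integrable_const _)]
        simp

lemma min_measureReal_singleton_le [MeasurableSingletonClass β] (h : IsFresh m μ X ν)
    (hm : m ≤ mΩ) (hg : Measurable[m] g) (x y : β) :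
    min (ν.real {x}) (ν.real {y}) ≤ μ.real {ω | |f x - f y| / 2 ≤ |f (X ω) + g ω|} := by
  set far : Set Ω := {ω | |f x - f y| / 2 ≤ |f x + g ω|}
  have h_far : MeasurableSet[m] far :=
    measurableSet_le measurable_const (measurable_norm.comp (hg.const_add (f x)))
  have h_real : ∀ s, MeasurableSet[m] s → ∀ z,
      μ.real (s ∩ X ⁻¹' {z}) = μ.real s * ν.real {z} := fun s hs z => by
    simp only [measureReal_def,
      h.measure_inter_preimage s hs _ (measurableSet_singleton z), ENNReal.toReal_mul]
  calc min (ν.real {x}) (ν.real {y})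
      = μ.real far * min (ν.real {x}) (ν.real {y})
          + μ.real farᶜ * min (ν.real {x}) (ν.real {y}) := by
        rw [← add_mul, probReal_add_probReal_compl (hm _ h_far), one_mul]
    _ ≤ μ.real (far ∩ X ⁻¹' {x}) + μ.real (farᶜ ∩ X ⁻¹' {y}) := by
        rw [h_real _ h_far, h_real _ h_far.compl]
        gcongr
        · exact min_le_left _ _
        · exact min_le_right _ _
    _ = μ.real (far ∩ X ⁻¹' {x} ∪ farᶜ ∩ X ⁻¹' {y}) := by
        refine (measureReal_union ?_ ?_).symm
        · exact (disjoint_compl_right.mono Set.inter_subset_left Set.inter_subset_left)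
        · exact (hm _ h_far).compl.inter (h.measurable (measurableSet_singleton y))
    _ ≤ μ.real {ω | |f x - f y| / 2 ≤ |f (X ω) + g ω|} := by
        refine measureReal_mono ?_
        rintro ω (⟨hω, hX : X ω = x⟩ | ⟨hω, hX : X ω = y⟩)
        · rw [Set.mem_ofPred_eq, hX]
          exact hω
        · have h_tri := abs_sub_le (f x + g ω) 0 (f y + g ω)
          simp only [far, Set.mem_compl_iff, Set.mem_ofPred_eq, not_le] at hω
          simp only [Set.mem_ofPred_eq, hX]
          simp only [add_sub_add_right_eq_sub, sub_zero, zero_sub, abs_neg] at h_tri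
          linarith

lemma not_tendstoInMeasure_add [MeasurableSingletonClass β] {𝒢 : ℕ → MeasurableSpace Ω}
    {X : ℕ → Ω → β} {g : ℕ → Ω → ℝ} (h : ∀ t, IsFresh (𝒢 t) μ (X t) ν) (h𝒢 : ∀ t, 𝒢 t ≤ mΩ)
    (hg : ∀ t, Measurable[𝒢 t] (g t)) {x y : β} (hx : ν {x} ≠ 0) (hy : ν {y} ≠ 0)
    (hxy : f x ≠ f y) :
    ¬ TendstoInMeasure μ (fun t ω => f (X t ω) + g t ω) atTop 0 := by
  have := (h 0).isProbabilityMeasure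
  have h_pos : 0 < min (ν.real {x}) (ν.real {y}) := lt_min
    (ENNReal.toReal_pos hx (measure_ne_top _ _)) (ENNReal.toReal_pos hy (measure_ne_top _ _))
  intro h_lim
  have h_far := tendstoInMeasure_iff_measureReal_norm.1 h_lim (|f x - f y| / 2)
    (half_pos (abs_pos.2 (sub_ne_zero.2 hxy)))
  refine h_pos.not_ge (ge_of_tendsto' h_far fun t => ?_)
  simpa using (h t).min_measureReal_singleton_le (h𝒢 t) (hg t) x y

end IsFresh

end Fresh

section LinearPartialSums

variable {x : ℕ → ℝ} {C : ℝ}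

lemma frequently_le_of_sum_le (hx : 0 ≤ x)
    (h : ∀ᶠ T : ℕ in atTop, ∑ t ∈ Finset.range T, x t ≤ C * T) :
    ∃ᶠ t in atTop, x t ≤ 2 * C := by
  obtain ⟨n₀, hn₀⟩ := eventually_atTop.1 h
  refine frequently_atTop.2 fun a => ?_
  set n := max a (max n₀ 1)
  obtain ⟨t, ht, htC⟩ : ∃ t ∈ Finset.Ico n (2 * n), x t ≤ 2 * C := by
    refine Finset.exists_le_of_sum_le (Finset.nonempty_Ico.2 (by omega)) ?_
    calc ∑ t ∈ Finset.Ico n (2 * n), x t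
        ≤ ∑ t ∈ Finset.range (2 * n), x t :=
          Finset.sum_le_sum_of_subset_of_nonneg
            (fun t ht => Finset.mem_range.2 (Finset.mem_Ico.1 ht).2) fun t _ _ => hx t
      _ ≤ C * (2 * n : ℕ) := hn₀ (2 * n) (by omega)
      _ = ∑ _t ∈ Finset.Ico n (2 * n), 2 * C := by
          rw [Finset.sum_const, Nat.card_Ico, nsmul_eq_mul, two_mul n, Nat.add_sub_cancel]
          push_cast
          ring
  exact ⟨t, (le_max_left _ _).trans (Finset.mem_Ico.1 ht).1, htC⟩

lemma exists_strictMono_tendsto_div_zero (hx : 0 ≤ x)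
    (h : ∀ᶠ T : ℕ in atTop, ∑ t ∈ Finset.range T, x t ≤ C * T) :
    ∃ φ : ℕ → ℕ, StrictMono φ ∧ Tendsto (fun k => x (φ k) / φ k) atTop (nhds 0) := by
  obtain ⟨φ, hφ, hφx⟩ := extraction_of_frequently_atTop (frequently_le_of_sum_le hx h)
  refine ⟨φ, hφ, squeeze_zero (fun k => div_nonneg (hx _) (Nat.cast_nonneg _)) (fun k => ?_)
    ((tendsto_const_div_atTop_nhds_zero_nat (2 * C)).comp hφ.tendsto_atTop)⟩
  exact div_le_div_of_nonneg_right (hφx k) (Nat.cast_nonneg _)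

lemma le_of_monotone_of_sum_le (hmono : Monotone x) (hx : 0 ≤ x)
    (h : ∀ᶠ T : ℕ in atTop, ∑ t ∈ Finset.range T, x t ≤ C * T) (t : ℕ) : x t ≤ 2 * C := by
  obtain ⟨s, hs, hsC⟩ := frequently_atTop.1 (frequently_le_of_sum_le hx h) t
  exact (hmono hs).trans hsC

end LinearPartialSums

section Server

variable {Ω : Type*} {mΩ : MeasurableSpace Ω} {μ : Measure Ω} {𝒢 : ℕ → MeasurableSpace Ω}
  {ν : Measure ℕ} {u n S : ℕ → Ω → ℕ}

/-- A device that serves one task at a time: in slot `t` it starts `u t ≤ 1` tasks, the task that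
it may start would last `n t` slots, and it remains busy for `S t` slots. The service times have
law `ν` and are fresh for the σ-algebras `𝒢 t`, on which the decisions are based. -/
structure Server (𝒢 : ℕ → MeasurableSpace Ω) {mΩ : MeasurableSpace Ω} (μ : Measure Ω)
    (ν : Measure ℕ) (u n S : ℕ → Ω → ℕ) : Prop where
  le : ∀ t, 𝒢 t ≤ mΩ
  u_le_one : ∀ t ω, u t ω ≤ 1
  idle : ∀ t ω, u t ω = 1 → S t ω = 0
  S_zero : ∀ ω, S 0 ω = 0
  S_succ : ∀ t ω, S (t + 1) ω = if u t ω = 1 then n t ω - 1 else S t ω - 1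
  measurable_u : ∀ t, Measurable[𝒢 t] (u t)
  measurable_S : ∀ t, Measurable[𝒢 t] (S t)
  isFresh : ∀ t, IsFresh (𝒢 t) μ (n t) ν
  memLp : MemLp (fun k : ℕ => (k : ℝ)) 2 ν

namespace Server

lemma sq_add_sum_le (h : Server 𝒢 μ ν u n S) (T : ℕ) (ω : Ω) :
    S T ω ^ 2 + ∑ t ∈ Finset.range T, S t ω ≤ ∑ t ∈ Finset.range T, n t ω ^ 2 := by
  induction T with
  | zero => simp [h.S_zero]
  | succ T ih =>
    suffices S (T + 1) ω ^ 2 + S T ω ≤ S T ω ^ 2 + n T ω ^ 2 by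
      rw [Finset.sum_range_succ, Finset.sum_range_succ]
      omega
    rw [h.S_succ]
    split_ifs with hu
    · rw [h.idle T ω hu]
      simpa using Nat.pow_le_pow_left (Nat.sub_le (n T ω) 1) 2
    · rcases S T ω with _ | k
      · simp
      · rw [Nat.add_sub_cancel]
        nlinarith

lemma add_mul_le_succ (h : Server 𝒢 μ ν u n S) (t : ℕ) (ω : Ω) :
    S t ω + u t ω * n t ω ≤ S (t + 1) ω + 1 := by
  rw [h.S_succ]
  split_ifs with hu
  · rw [h.idle t ω hu, hu]
    omega
  · have hu0 : u t ω = 0 := by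
      have := h.u_le_one t ω
      omega
    rw [hu0]
    omega

lemma measurable_cast_u (h : Server 𝒢 μ ν u n S) (t : ℕ) :
    Measurable[𝒢 t] fun ω => (u t ω : ℝ) :=
  measurable_from_nat.comp (h.measurable_u t)

variable [IsProbabilityMeasure μ]

lemma memLp_n (h : Server 𝒢 μ ν u n S) (t : ℕ) : MemLp (fun ω => (n t ω : ℝ)) 2 μ :=
  h.memLp.comp_measurePreserving (h.isFresh t).measurePreserving

lemma memLp_u (h : Server 𝒢 μ ν u n S) (t : ℕ) : MemLp (fun ω => (u t ω : ℝ)) 2 μ :=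
  .of_bound ((h.measurable_cast_u t).mono (h.le t) le_rfl).aestronglyMeasurable 1
    (ae_of_all _ fun ω => by simpa using h.u_le_one t ω)

lemma memLp_S (h : Server 𝒢 μ ν u n S) (t : ℕ) : MemLp (fun ω => (S t ω : ℝ)) 2 μ := by
  induction t with
  | zero => simp [h.S_zero]
  | succ t ih =>
    have h_meas : Measurable (S (t + 1)) := (h.measurable_S (t + 1)).mono (h.le _) le_rfl
    refine (ih.add (h.memLp_n t)).mono (measurable_from_nat.comp h_meas).aestronglyMeasurable
      (ae_of_all _ fun ω => ?_)
    have hS : S (t + 1) ω ≤ S t ω + n t ω := by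
      rw [h.S_succ]
      split_ifs <;> omega
    rw [Real.norm_natCast, Pi.add_apply, ← Nat.cast_add, Real.norm_natCast]
    exact_mod_cast hS

lemma integrable_u (h : Server 𝒢 μ ν u n S) (t : ℕ) : Integrable (fun ω => (u t ω : ℝ)) μ :=
  (h.memLp_u t).integrable one_le_two

lemma integrable_S (h : Server 𝒢 μ ν u n S) (t : ℕ) : Integrable (fun ω => (S t ω : ℝ)) μ :=
  (h.memLp_S t).integrable one_le_two

lemma integral_sq_add_sum_le (h : Server 𝒢 μ ν u n S) (T : ℕ) :
    ∫ ω, (S T ω : ℝ) ^ 2 ∂μ + ∑ t ∈ Finset.range T, ∫ ω, (S t ω : ℝ) ∂μ ≤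
      T * ∫ k : ℕ, (k : ℝ) ^ 2 ∂ν := by
  have h_sum := integrable_finsetSum (Finset.range T) fun t _ => h.integrable_S t
  calc ∫ ω, (S T ω : ℝ) ^ 2 ∂μ + ∑ t ∈ Finset.range T, ∫ ω, (S t ω : ℝ) ∂μ
      = ∫ ω, ((S T ω : ℝ) ^ 2 + ∑ t ∈ Finset.range T, (S t ω : ℝ)) ∂μ := by
        rw [integral_add (h.memLp_S T).integrable_sq h_sum,
          integral_finsetSum _ fun t _ => h.integrable_S t]
    _ ≤ ∫ ω, ∑ t ∈ Finset.range T, (n t ω : ℝ) ^ 2 ∂μ := by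
        refine integral_mono ((h.memLp_S T).integrable_sq.add h_sum)
          (integrable_finsetSum _ fun t _ => (h.memLp_n t).integrable_sq) fun ω => ?_
        exact_mod_cast h.sq_add_sum_le T ω
    _ = T * ∫ k : ℕ, (k : ℝ) ^ 2 ∂ν := by
        rw [integral_finsetSum _ fun t _ => (h.memLp_n t).integrable_sq]
        simp [fun t => (h.isFresh t).integral_comp (f := fun k : ℕ => (k : ℝ) ^ 2)
          measurable_from_nat]

lemma sum_integral_S_le (h : Server 𝒢 μ ν u n S) (T : ℕ) :
    ∑ t ∈ Finset.range T, ∫ ω, (S t ω : ℝ) ∂μ ≤ T * ∫ k : ℕ, (k : ℝ) ^ 2 ∂ν :=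
  (le_add_of_nonneg_left (integral_nonneg fun _ => sq_nonneg _)).trans (h.integral_sq_add_sum_le T)

lemma integral_S_le_sqrt (h : Server 𝒢 μ ν u n S) (T : ℕ) :
    ∫ ω, (S T ω : ℝ) ∂μ ≤ √(T * ∫ k : ℕ, (k : ℝ) ^ 2 ∂ν) := by
  have h_jensen : (∫ ω, (S T ω : ℝ) ∂μ) ^ 2 ≤ ∫ ω, (S T ω : ℝ) ^ 2 ∂μ := by
    have h_var := variance_nonneg (fun ω => (S T ω : ℝ)) μ
    rw [variance_eq_sub (h.memLp_S T)] at h_var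
    exact sub_nonneg.1 h_var
  have h_sum : 0 ≤ ∑ t ∈ Finset.range T, ∫ ω, (S t ω : ℝ) ∂μ :=
    Finset.sum_nonneg fun t _ => integral_nonneg fun ω => Nat.cast_nonneg _
  exact Real.le_sqrt_of_sq_le (by linarith [h.integral_sq_add_sum_le T])

lemma tendsto_integral_S_div (h : Server 𝒢 μ ν u n S) :
    Tendsto (fun T : ℕ => (∫ ω, (S T ω : ℝ) ∂μ) / T) atTop (nhds 0) := by
  have h_sqrt : Tendsto (fun T : ℕ => √((∫ k : ℕ, (k : ℝ) ^ 2 ∂ν) / T)) atTop (nhds 0) := by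
    simpa using (tendsto_const_div_atTop_nhds_zero_nat (∫ k : ℕ, (k : ℝ) ^ 2 ∂ν)).sqrt
  refine squeeze_zero (fun T => ?_) (fun T => ?_) h_sqrt
  · exact div_nonneg (integral_nonneg fun ω => Nat.cast_nonneg _) (Nat.cast_nonneg _)
  · calc (∫ ω, (S T ω : ℝ) ∂μ) / T ≤ √(T * ∫ k : ℕ, (k : ℝ) ^ 2 ∂ν) / T := by
          gcongr
          exact h.integral_S_le_sqrt T
      _ = √((∫ k : ℕ, (k : ℝ) ^ 2 ∂ν) / T) := by
          rw [mul_comm, Real.sqrt_mul' _ (Nat.cast_nonneg _), Real.sqrt_div' _ (Nat.cast_nonneg _),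
            mul_div_assoc, Real.sqrt_div_self, ← div_eq_mul_inv]

lemma sum_integral_u_mul_le (h : Server 𝒢 μ ν u n S) (T : ℕ) :
    (∑ t ∈ Finset.range T, ∫ ω, (u t ω : ℝ) ∂μ) * ∫ k : ℕ, (k : ℝ) ∂ν ≤
      T + ∫ ω, (S T ω : ℝ) ∂μ := by
  induction T with
  | zero => simp [h.S_zero]
  | succ T ih =>
    have h_mul : Integrable (fun ω => (u T ω : ℝ) * n T ω) μ :=
      (h.memLp_u T).integrable_mul (h.memLp_n T)
    have h_step : ∫ ω, (S T ω : ℝ) ∂μ + (∫ ω, (u T ω : ℝ) ∂μ) * ∫ k : ℕ, (k : ℝ) ∂ν ≤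
        ∫ ω, (S (T + 1) ω : ℝ) ∂μ + 1 := by
      calc _ = ∫ ω, ((S T ω : ℝ) + u T ω * n T ω) ∂μ := by
            rw [integral_add (h.integrable_S T) h_mul, (h.isFresh T).integral_mul (h.le T)
              (h.measurable_cast_u T) (f := fun k : ℕ => (k : ℝ)) measurable_from_nat]
        _ ≤ ∫ ω, ((S (T + 1) ω : ℝ) + 1) ∂μ := by
            refine integral_mono ((h.integrable_S T).add h_mul)
              ((h.integrable_S (T + 1)).add (integrable_const _)) fun ω => ?_
            exact_mod_cast h.add_mul_le_succ T ω
        _ = _ := by simp [integral_add (h.integrable_S (T + 1)) (integrable_const (1 : ℝ))]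
    rw [Finset.sum_range_succ, add_mul]
    push_cast
    linarith

lemma exists_tendsto_rate_le (h : Server 𝒢 μ ν u n S) (hν : 0 < ∫ k : ℕ, (k : ℝ) ∂ν) :
    ∃ r : ℕ → ℝ, Tendsto r atTop (nhds (1 / ∫ k : ℕ, (k : ℝ) ∂ν)) ∧
      ∀ T : ℕ, (∑ t ∈ Finset.range T, ∫ ω, (u t ω : ℝ) ∂μ) / T ≤ r T := by
  refine ⟨fun T => (1 + (∫ ω, (S T ω : ℝ) ∂μ) / T) / ∫ k : ℕ, (k : ℝ) ∂ν, ?_, fun T => ?_⟩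
  · simpa using (h.tendsto_integral_S_div.const_add 1).div_const (∫ k : ℕ, (k : ℝ) ∂ν)
  · rw [le_div_iff₀ hν, div_mul_eq_mul_div]
    calc _ ≤ (T + ∫ ω, (S T ω : ℝ) ∂μ) / T := by
          gcongr
          exact h.sum_integral_u_mul_le T
      _ ≤ 1 + (∫ ω, (S T ω : ℝ) ∂μ) / T := by
          rw [add_div]
          gcongr
          exact div_self_le_one _

end Server

end Server

section ServedQueue

variable {Ω : Type*} {mΩ : MeasurableSpace Ω} {μ : Measure Ω} {𝒢 : ℕ → MeasurableSpace Ω}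
  {ν α : Measure ℕ} {u n S q a : ℕ → Ω → ℕ} {m : ℝ}

/-- A queue with its own server, which starts a task whenever it is idle and the queue is not
empty. The numbers `a t` of arrivals have law `α` and, like the service times, are fresh for
`𝒢 t`. -/
structure ServedQueue (𝒢 : ℕ → MeasurableSpace Ω) {mΩ : MeasurableSpace Ω} (μ : Measure Ω)
    (ν α : Measure ℕ) (u n S q a : ℕ → Ω → ℕ) : Prop extends Server 𝒢 μ ν u n S where
  q_zero : ∀ ω, q 0 ω = 0
  q_succ : ∀ t ω, q (t + 1) ω = q t ω - u t ω + a t ω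
  u_eq : ∀ t ω, u t ω = if S t ω = 0 ∧ 0 < q t ω then 1 else 0
  measurable_q : ∀ t, Measurable[𝒢 t] (q t)
  isFresh_arrivals : ∀ t, IsFresh (𝒢 t) μ (a t) α
  memLp_arrivals : MemLp (fun k : ℕ => (k : ℝ)) 2 α
  one_le_service : ∀ᵐ k ∂ν, 1 ≤ k

/-- The expected number of slots needed to serve the queue and the task being served, when a task
takes `m` slots on average. -/
def workload (m : ℝ) (q S : ℕ → Ω → ℕ) (t : ℕ) (ω : Ω) : ℝ := m * q t ω + S t ω

namespace ServedQueue

lemma exists_workload_succ_eq (h : ServedQueue 𝒢 μ ν α u n S q a) {t : ℕ} {ω : Ω}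
    (hn : 1 ≤ n t ω) : ∃ w : ℝ, w ^ 2 ≤ 1 ∧ workload m q S t ω * w = workload m q S t ω ∧
      workload m q S (t + 1) ω =
        workload m q S t ω + (m * a t ω + u t ω * (n t ω - m) - w) := by
  simp only [workload, h.q_succ, h.S_succ, h.u_eq]
  rcases Nat.eq_zero_or_pos (S t ω) with hS | hS
  · rcases Nat.eq_zero_or_pos (q t ω) with hq | hq
    · exact ⟨0, by simp, by simp [hS, hq], by simp [hS, hq]⟩
    · refine ⟨1, by simp, by simp, ?_⟩
      simp only [hS, hq, and_self, if_true, Nat.cast_add, Nat.cast_sub hq, Nat.cast_sub hn]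
      push_cast
      ring
  · refine ⟨1, by simp, by simp, ?_⟩
    simp only [hS.ne', false_and, if_false, zero_ne_one, tsub_zero, Nat.cast_add,
      Nat.cast_sub (Nat.succ_le_iff.2 hS)]
    push_cast
    ring

lemma workload_sq_succ_le (h : ServedQueue 𝒢 μ ν α u n S q a) {t : ℕ} {ω : Ω}
    (hn : 1 ≤ n t ω) : workload m q S (t + 1) ω ^ 2 ≤ workload m q S t ω ^ 2 +
      2 * (workload m q S t ω * (m * a t ω - 1)) +
      2 * (workload m q S t ω * u t ω * (n t ω - m)) +
      3 * ((m * a t ω) ^ 2 + (n t ω - m) ^ 2 + 1) := by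
  obtain ⟨w, hw_sq, hw, h_succ⟩ := h.exists_workload_succ_eq (m := m) hn
  have hu : (u t ω : ℝ) ^ 2 ≤ 1 :=
    pow_le_one₀ (Nat.cast_nonneg _) (Nat.cast_le_one.2 (h.u_le_one t ω))
  have h_service : ((u t ω : ℝ) * (n t ω - m)) ^ 2 ≤ (n t ω - m) ^ 2 := by
    rw [mul_pow]
    exact mul_le_of_le_one_left (sq_nonneg _) hu
  have h_step (x y z : ℝ) : (x + y - z) ^ 2 ≤ 3 * (x ^ 2 + y ^ 2 + z ^ 2) := by
    nlinarith [sq_nonneg (x - y), sq_nonneg (x + z), sq_nonneg (y + z)]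
  calc workload m q S (t + 1) ω ^ 2
      = workload m q S t ω ^ 2 + 2 * (workload m q S t ω * (m * a t ω)) +
          2 * (workload m q S t ω * u t ω * (n t ω - m)) - 2 * (workload m q S t ω * w) +
          (m * a t ω + u t ω * (n t ω - m) - w) ^ 2 := by
        rw [h_succ]
        ring
    _ ≤ _ := by
        rw [hw]
        linarith [h_step (m * a t ω) (u t ω * (n t ω - m)) w]

lemma u_le_q (h : ServedQueue 𝒢 μ ν α u n S q a) (t : ℕ) (ω : Ω) : u t ω ≤ q t ω := by
  rw [h.u_eq]
  split_ifs <;> omega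

lemma q_add_sum_u (h : ServedQueue 𝒢 μ ν α u n S q a) (T : ℕ) (ω : Ω) :
    q T ω + ∑ t ∈ Finset.range T, u t ω = ∑ t ∈ Finset.range T, a t ω := by
  induction T with
  | zero => simp [h.q_zero]
  | succ T ih =>
    rw [Finset.sum_range_succ, Finset.sum_range_succ, ← ih, h.q_succ]
    have := h.u_le_q T ω
    omega

lemma measurable_workload (h : ServedQueue 𝒢 μ ν α u n S q a) (t : ℕ) :
    Measurable[𝒢 t] (workload m q S t) :=
  ((measurable_from_nat.comp (h.measurable_q t)).const_mul m).add
    (measurable_from_nat.comp (h.measurable_S t))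

variable [IsProbabilityMeasure μ]

lemma memLp_a (h : ServedQueue 𝒢 μ ν α u n S q a) (t : ℕ) :
    MemLp (fun ω => (a t ω : ℝ)) 2 μ :=
  h.memLp_arrivals.comp_measurePreserving (h.isFresh_arrivals t).measurePreserving

lemma memLp_q (h : ServedQueue 𝒢 μ ν α u n S q a) (t : ℕ) :
    MemLp (fun ω => (q t ω : ℝ)) 2 μ := by
  induction t with
  | zero => simp [h.q_zero]
  | succ t ih =>
    have h_meas : Measurable (q (t + 1)) := (h.measurable_q (t + 1)).mono (h.le _) le_rfl
    refine (ih.add (h.memLp_a t)).mono (measurable_from_nat.comp h_meas).aestronglyMeasurable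
      (ae_of_all _ fun ω => ?_)
    have hq : q (t + 1) ω ≤ q t ω + a t ω := by
      rw [h.q_succ]
      omega
    rw [Real.norm_natCast, Pi.add_apply, ← Nat.cast_add, Real.norm_natCast]
    exact_mod_cast hq

lemma memLp_workload (h : ServedQueue 𝒢 μ ν α u n S q a) (t : ℕ) :
    MemLp (workload m q S t) 2 μ :=
  ((h.memLp_q t).const_mul m).add (h.memLp_S t)

lemma memLp_workload_mul_u (h : ServedQueue 𝒢 μ ν α u n S q a) (t : ℕ) :
    MemLp (fun ω => workload m q S t ω * u t ω) 2 μ := by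
  refine (h.memLp_workload (m := m) t).mono ((((h.measurable_workload t).mul
    (h.measurable_cast_u t)).mono (h.le t) le_rfl).aestronglyMeasurable)
    (ae_of_all _ fun ω => ?_)
  rw [norm_mul, Real.norm_natCast]
  exact mul_le_of_le_one_right (norm_nonneg _) (Nat.cast_le_one.2 (h.u_le_one t ω))

lemma integral_workload_mul_u_mul_sub (h : ServedQueue 𝒢 μ ν α u n S q a) (t : ℕ) :
    ∫ ω, workload m q S t ω * u t ω * (n t ω - ∫ k : ℕ, (k : ℝ) ∂ν) ∂μ = 0 := by
  have := (h.isFresh t).isProbabilityMeasure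
  simpa using (h.isFresh t).setIntegral_mul_sub_integral (h.le t)
    ((h.measurable_workload (m := m) t).mul (h.measurable_cast_u t))
    (f := fun k : ℕ => (k : ℝ)) measurable_from_nat (h.memLp.integrable one_le_two) .univ

lemma integral_workload_mul_arrivals_sub (h : ServedQueue 𝒢 μ ν α u n S q a) (t : ℕ) :
    ∫ ω, workload m q S t ω * (m * a t ω - 1) ∂μ =
      (∫ ω, workload m q S t ω ∂μ) * ∫ k : ℕ, (m * k - 1) ∂α :=
  (h.isFresh_arrivals t).integral_mul (h.le t) (h.measurable_workload t)
    (f := fun k : ℕ => m * (k : ℝ) - 1) measurable_from_nat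

lemma integral_sq_add_sq_add_one (h : ServedQueue 𝒢 μ ν α u n S q a) (t : ℕ) :
    ∫ ω, ((m * a t ω) ^ 2 + ((n t ω : ℝ) - m) ^ 2 + 1) ∂μ =
      ∫ k : ℕ, (m * k) ^ 2 ∂α + ∫ k : ℕ, (k - m) ^ 2 ∂ν + 1 := by
  have ha : Integrable (fun ω => (m * (a t ω : ℝ)) ^ 2) μ :=
    ((h.memLp_a t).const_mul m).integrable_sq
  have hn : Integrable (fun ω => ((n t ω : ℝ) - m) ^ 2) μ :=
    ((h.memLp_n t).sub (memLp_const m)).integrable_sq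
  have h_sum : Integrable (fun ω => (m * (a t ω : ℝ)) ^ 2 + ((n t ω : ℝ) - m) ^ 2) μ := ha.add hn
  rw [integral_add h_sum (integrable_const 1), integral_add ha hn,
    (h.isFresh_arrivals t).integral_comp (f := fun k : ℕ => (m * (k : ℝ)) ^ 2)
      measurable_from_nat,
    (h.isFresh t).integral_comp (f := fun k : ℕ => ((k : ℝ) - m) ^ 2) measurable_from_nat]
  simp

lemma integral_workload_sq_succ_le (h : ServedQueue 𝒢 μ ν α u n S q a)
    (hm : m = ∫ k : ℕ, (k : ℝ) ∂ν) (t : ℕ) :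
    ∫ ω, workload m q S (t + 1) ω ^ 2 ∂μ ≤ ∫ ω, workload m q S t ω ^ 2 ∂μ +
      2 * ((∫ ω, workload m q S t ω ∂μ) * ∫ k : ℕ, (m * k - 1) ∂α) +
      3 * (∫ k : ℕ, (m * k) ^ 2 ∂α + ∫ k : ℕ, (k - m) ^ 2 ∂ν + 1) := by
  have hV := h.memLp_workload (m := m) t
  have ha : MemLp (fun ω => m * (a t ω : ℝ)) 2 μ := (h.memLp_a t).const_mul m
  have hn : MemLp (fun ω => (n t ω : ℝ) - m) 2 μ := (h.memLp_n t).sub (memLp_const m)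
  have hVa : Integrable (fun ω => workload m q S t ω * (m * a t ω - 1)) μ :=
    hV.integrable_mul (ha.sub (memLp_const 1))
  have hVn : Integrable (fun ω => workload m q S t ω * u t ω * (n t ω - m)) μ :=
    (h.memLp_workload_mul_u t).integrable_mul hn
  have h_ae : ∀ᵐ ω ∂μ, 1 ≤ n t ω :=
    (h.isFresh t).measurePreserving.quasiMeasurePreserving.ae h.one_le_service
  have h_service := h.integral_workload_mul_u_mul_sub (m := m) t
  rw [← hm] at h_service
  have h_lin : Integrable (fun ω => workload m q S t ω ^ 2 +
      2 * (workload m q S t ω * (m * a t ω - 1))) μ :=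
    hV.integrable_sq.add (hVa.const_mul 2)
  have h_cross : Integrable (fun ω => workload m q S t ω ^ 2 +
      2 * (workload m q S t ω * (m * a t ω - 1)) +
      2 * (workload m q S t ω * u t ω * (n t ω - m))) μ :=
    h_lin.add (hVn.const_mul 2)
  have h_sq : Integrable (fun ω => (m * a t ω) ^ 2 + ((n t ω : ℝ) - m) ^ 2 + 1) μ :=
    (ha.integrable_sq.add hn.integrable_sq).add (integrable_const 1)
  calc ∫ ω, workload m q S (t + 1) ω ^ 2 ∂μ
      ≤ ∫ ω, (workload m q S t ω ^ 2 + 2 * (workload m q S t ω * (m * a t ω - 1)) +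
          2 * (workload m q S t ω * u t ω * (n t ω - m)) +
          3 * ((m * a t ω) ^ 2 + (n t ω - m) ^ 2 + 1)) ∂μ :=
        integral_mono_ae (h.memLp_workload (t + 1)).integrable_sq
          (h_cross.add (h_sq.const_mul 3))
          (h_ae.mono fun ω hω => h.workload_sq_succ_le hω)
    _ = _ := by
        rw [integral_add h_cross (h_sq.const_mul 3), integral_add h_lin (hVn.const_mul 2),
          integral_add hV.integrable_sq (hVa.const_mul 2)]
        simp only [integral_const_mul]
        rw [h.integral_workload_mul_arrivals_sub, h_service, h.integral_sq_add_sq_add_one,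
          mul_zero, add_zero]

lemma sum_integral_u_le (h : ServedQueue 𝒢 μ ν α u n S q a) (T : ℕ) :
    ∑ t ∈ Finset.range T, ∫ ω, (u t ω : ℝ) ∂μ ≤ T * ∫ k : ℕ, (k : ℝ) ∂α := by
  have h_a (t : ℕ) := (h.memLp_a t).integrable one_le_two
  calc ∑ t ∈ Finset.range T, ∫ ω, (u t ω : ℝ) ∂μ
      = ∫ ω, ∑ t ∈ Finset.range T, (u t ω : ℝ) ∂μ :=
        (integral_finsetSum _ fun t _ => h.integrable_u t).symm
    _ ≤ ∫ ω, ∑ t ∈ Finset.range T, (a t ω : ℝ) ∂μ :=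
        integral_mono (integrable_finsetSum _ fun t _ => h.integrable_u t)
          (integrable_finsetSum _ fun t _ => h_a t) fun ω => by
            exact_mod_cast (Nat.le_add_left _ _).trans_eq (h.q_add_sum_u T ω)
    _ = T * ∫ k : ℕ, (k : ℝ) ∂α := by
        rw [integral_finsetSum _ fun t _ => h_a t]
        simp [(h.isFresh_arrivals _).integral_comp measurable_from_nat]

/-- The square of the workload is a Lyapunov function. -/
lemma mul_sum_integral_workload_le (h : ServedQueue 𝒢 μ ν α u n S q a)
    (hm : m = ∫ k : ℕ, (k : ℝ) ∂ν) (T : ℕ) :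
    -(2 * ∫ k : ℕ, (m * k - 1) ∂α) * ∑ t ∈ Finset.range T, ∫ ω, workload m q S t ω ∂μ ≤
      3 * (∫ k : ℕ, (m * k) ^ 2 ∂α + ∫ k : ℕ, (k - m) ^ 2 ∂ν + 1) * T := by
  suffices h_sq : ∫ ω, workload m q S T ω ^ 2 ∂μ + -(2 * ∫ k : ℕ, (m * k - 1) ∂α) *
      ∑ t ∈ Finset.range T, ∫ ω, workload m q S t ω ∂μ ≤
      3 * (∫ k : ℕ, (m * k) ^ 2 ∂α + ∫ k : ℕ, (k - m) ^ 2 ∂ν + 1) * T from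
    (le_add_of_nonneg_left (integral_nonneg fun _ => sq_nonneg _)).trans h_sq
  induction T with
  | zero => simp [workload, h.q_zero, h.S_zero]
  | succ T ih =>
    rw [Finset.sum_range_succ]
    push_cast
    linarith [h.integral_workload_sq_succ_le hm T]

lemma mul_integral_q_le (h : ServedQueue 𝒢 μ ν α u n S q a) (t : ℕ) :
    m * ∫ ω, (q t ω : ℝ) ∂μ ≤ ∫ ω, workload m q S t ω ∂μ := by
  rw [← integral_const_mul]
  exact integral_mono (((h.memLp_q t).integrable one_le_two).const_mul m)
    ((h.memLp_workload t).integrable one_le_two)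
    fun ω => le_add_of_nonneg_right (Nat.cast_nonneg _)

lemma exists_sum_integral_q_le (h : ServedQueue 𝒢 μ ν α u n S q a)
    (h_load : (∫ k : ℕ, (k : ℝ) ∂α) * ∫ k : ℕ, (k : ℝ) ∂ν < 1) :
    ∃ C : ℝ, ∀ T : ℕ, ∑ t ∈ Finset.range T, ∫ ω, (q t ω : ℝ) ∂μ ≤ C * T := by
  set m := ∫ k : ℕ, (k : ℝ) ∂ν with hm
  set c := -(2 * ∫ k : ℕ, (m * k - 1) ∂α) with hc
  have := (h.isFresh 0).isProbabilityMeasure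
  have := (h.isFresh_arrivals 0).isProbabilityMeasure
  have hm_pos : 0 < m := by
    have h_one : ∫ _ : ℕ, (1 : ℝ) ∂ν ≤ m :=
      integral_mono_ae (integrable_const 1) (h.memLp.integrable one_le_two)
        (h.one_le_service.mono fun k hk => Nat.one_le_cast.2 hk)
    exact one_pos.trans_le (by simpa using h_one)
  have hc_pos : 0 < c := by
    rw [hc, integral_sub ((h.memLp_arrivals.integrable one_le_two).const_mul m)
      (integrable_const 1), integral_const_mul]
    simp only [integral_const, probReal_univ, smul_eq_mul]
    linarith
  refine ⟨3 * (∫ k : ℕ, (m * k) ^ 2 ∂α + ∫ k : ℕ, (k - m) ^ 2 ∂ν + 1) / (c * m), fun T => ?_⟩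
  rw [div_mul_eq_mul_div, le_div_iff₀ (mul_pos hc_pos hm_pos)]
  calc (∑ t ∈ Finset.range T, ∫ ω, (q t ω : ℝ) ∂μ) * (c * m)
      = c * ∑ t ∈ Finset.range T, m * ∫ ω, (q t ω : ℝ) ∂μ := by
        rw [← Finset.mul_sum]
        ring
    _ ≤ c * ∑ t ∈ Finset.range T, ∫ ω, workload m q S t ω ∂μ := by
        gcongr with t
        exact h.mul_integral_q_le t
    _ ≤ _ := h.mul_sum_integral_workload_le hm T

end ServedQueue

end ServedQueue

namespace Slot

variable {N : ℕ}

lemma measurable_toProd : Measurable (toProd (N := N)) := comap_measurable _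

lemma measurable_ofProd : Measurable (ofProd (N := N)) := by
  refine measurable_comap_iff.2 ?_
  exact measurable_id

lemma measurable_A : Measurable (A (N := N)) := measurable_fst.comp measurable_toProd

/-- What chance supplies in one slot apart from the arrival: the two tasks and the seed. -/
def rest (x : Slot N) : Task N × Task N × I := x.toProd.2

lemma measurable_rest : Measurable (rest (N := N)) := measurable_snd.comp measurable_toProd

lemma measurable_seed : Measurable (seed (N := N)) :=
  (measurable_snd.comp measurable_snd).comp measurable_rest

end Slot

namespace System

variable (sys : System)

instance : IsProbabilityMeasure sys.taskLaw := sys.isProbabilityMeasure_taskLaw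

instance : IsProbabilityMeasure sys.P := by
  unfold P
  infer_instance

/-- The law of the number of arrivals in one slot. -/
def arrivalLaw : Measure ℕ := bernoulliMeasure 1 0 sys.lam

instance : IsProbabilityMeasure sys.arrivalLaw := by
  unfold arrivalLaw
  infer_instance

lemma ae_arrivalLaw_le_one : ∀ᵐ k ∂sys.arrivalLaw, k ≤ 1 := by
  rw [ae_iff, arrivalLaw, bernoulliMeasure_apply_of_notMem_of_notMem _ .of_discrete] <;> simp

lemma arrivalLaw_singleton_one_ne_zero : sys.arrivalLaw {1} ≠ 0 := by
  rw [arrivalLaw, bernoulliMeasure_apply_of_mem_of_notMem _ .of_discrete (by simp) (by simp)]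
  exact ENNReal.coe_ne_zero.2 fun h => sys.lam_pos.ne' (Subtype.ext (congrArg NNReal.toReal h))

lemma arrivalLaw_singleton_zero_ne_zero (h : (sys.lam : ℝ) < 1) : sys.arrivalLaw {0} ≠ 0 := by
  rw [arrivalLaw, bernoulliMeasure_apply_of_notMem_of_mem _ .of_discrete (by simp) (by simp)]
  exact ENNReal.coe_ne_zero.2 fun h_zero => (sub_pos.2 h).ne' (congrArg NNReal.toReal h_zero)

lemma integral_arrivalLaw : ∫ k : ℕ, (k : ℝ) ∂sys.arrivalLaw = sys.lam := by
  simp [arrivalLaw, integral_bernoulliMeasure]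

lemma memLp_arrivalLaw : MemLp (fun k : ℕ => (k : ℝ)) 2 sys.arrivalLaw :=
  .of_bound measurable_from_nat.aestronglyMeasurable 1 <| sys.ae_arrivalLaw_le_one.mono
    fun k hk => by simpa using hk

lemma measurePreserving_toProd : MeasurePreserving Slot.toProd sys.slotLaw
    (sys.arrivalLaw.prod (sys.taskLaw.prod (sys.taskLaw.prod (volume : Measure I)))) where
  measurable := Slot.measurable_toProd
  map_eq := by
    rw [slotLaw, Measure.map_map Slot.measurable_toProd Slot.measurable_ofProd]
    exact Measure.map_id

lemma isFresh_slot_A : IsFresh (MeasurableSpace.comap Slot.rest inferInstance) sys.slotLaw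
    Slot.A sys.arrivalLaw := by
  have h := (IsFresh.fst_prod sys.arrivalLaw
    (sys.taskLaw.prod (sys.taskLaw.prod (volume : Measure I)))).comap
    sys.measurePreserving_toProd measurable_snd.comap_le
  rwa [MeasurableSpace.comap_comp] at h

lemma measurePreserving_rest : MeasurePreserving Slot.rest sys.slotLaw
    (sys.taskLaw.prod (sys.taskLaw.prod (volume : Measure I))) :=
  measurePreserving_snd.comp sys.measurePreserving_toProd

lemma isFresh_slot_task1 : IsFresh (MeasurableSpace.comap Slot.seed inferInstance) sys.slotLaw
    Slot.task1 sys.taskLaw := by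
  have h := (IsFresh.fst_prod sys.taskLaw (sys.taskLaw.prod (volume : Measure I))).comap
    sys.measurePreserving_rest measurable_snd.comap_le
  rw [MeasurableSpace.comap_comp] at h
  exact h.mono (measurable_snd.comp (comap_measurable (Prod.snd ∘ Slot.rest))).comap_le

lemma isFresh_slot_task2 : IsFresh (MeasurableSpace.comap Slot.seed inferInstance) sys.slotLaw
    Slot.task2 sys.taskLaw := by
  have h := (IsFresh.fst_prod sys.taskLaw (volume : Measure I)).comap
    (measurePreserving_snd.comp sys.measurePreserving_rest) measurable_snd.comap_le
  rwa [MeasurableSpace.comap_comp] at h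

/-- The σ-algebra of the slots before slot `t`. -/
@[reducible] def past (t : ℕ) : MeasurableSpace sys.Path :=
  ⨆ s : Fin t, MeasurableSpace.comap (fun ω : sys.Path => ω s) inferInstance

lemma past_le (t : ℕ) : sys.past t ≤ MeasurableSpace.pi :=
  iSup_le fun s => (measurable_pi_apply (s : ℕ)).comap_le

lemma info_le (t : ℕ) : sys.info t ≤ MeasurableSpace.pi :=
  sup_le (sys.past_le t) <| Measurable.comap_le <|
    Slot.measurable_seed.comp (measurable_pi_apply t)

lemma past_le_info (t : ℕ) : sys.past t ≤ sys.info t := le_sup_left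

lemma comap_le_past_succ (t : ℕ) :
    MeasurableSpace.comap (fun ω : sys.Path => ω t) inferInstance ≤ sys.past (t + 1) :=
  le_iSup (fun s : Fin (t + 1) => MeasurableSpace.comap (fun ω : sys.Path => ω s) inferInstance)
    (Fin.last t)

lemma past_mono : Monotone sys.past :=
  monotone_nat_of_le_succ fun t => iSup_le fun s =>
    le_iSup (fun s : Fin (t + 1) => MeasurableSpace.comap (fun ω : sys.Path => ω s) inferInstance)
      s.castSucc

/-- The σ-algebra of everything that happens up to slot `t`, except for the arrival in this
slot. -/
@[reducible] def preArrival (t : ℕ) : MeasurableSpace sys.Path :=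
  sys.past t ⊔ MeasurableSpace.comap (fun ω : sys.Path => (ω t).rest) inferInstance

lemma info_le_preArrival (t : ℕ) : sys.info t ≤ sys.preArrival t :=
  sup_le_sup_left (Measurable.comap_le <| (measurable_snd.comp measurable_snd).comp <|
    comap_measurable fun ω : sys.Path => (ω t).rest) _

lemma preArrival_le_past_succ (t : ℕ) : sys.preArrival t ≤ sys.past (t + 1) :=
  sup_le (sys.past_mono t.le_succ) <|
    (Slot.measurable_rest.comp (comap_measurable _)).comap_le.trans (sys.comap_le_past_succ t)

lemma measurable_eval (t : ℕ) : Measurable[sys.past (t + 1)] fun ω : sys.Path => ω t :=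
  (comap_measurable _).mono (sys.comap_le_past_succ t) le_rfl

lemma indep_past_eval (t : ℕ) :
    Indep (sys.past t) (MeasurableSpace.comap (fun ω : sys.Path => ω t) inferInstance) sys.P := by
  have h_indep : iIndepFun (fun (s : ℕ) (ω : sys.Path) => ω s) sys.P :=
    iIndepFun_infinitePi (X := fun _ x => x) (fun _ => measurable_id)
  have h_sup := indep_iSup_of_disjoint (S := Set.Iio t) (T := {t})
    (fun s => (measurable_pi_apply s).comap_le) h_indep (by simp)
  exact indep_of_indep_of_le h_sup (iSup_le fun s => le_iSup₂_of_le (s : ℕ) s.2 le_rfl)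
    (le_iSup₂_of_le t rfl le_rfl)

lemma isFresh_eval (t : ℕ) : IsFresh (sys.past t) sys.P (fun ω => ω t) sys.slotLaw :=
  .of_indep (sys.indep_past_eval t) (measurePreserving_eval_infinitePi _ t)

lemma isFresh_A (t : ℕ) : IsFresh (sys.preArrival t) sys.P (fun ω => (ω t).A) sys.arrivalLaw := by
  have h := (sys.isFresh_eval t).nested sys.isFresh_slot_A (sys.past_le t)
    Slot.measurable_rest.comap_le
  rwa [MeasurableSpace.comap_comp] at h

lemma isFresh_task1 (t : ℕ) : IsFresh (sys.info t) sys.P (fun ω => (ω t).task1) sys.taskLaw := by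
  have h := (sys.isFresh_eval t).nested sys.isFresh_slot_task1 (sys.past_le t)
    Slot.measurable_seed.comap_le
  rwa [MeasurableSpace.comap_comp] at h

lemma isFresh_task2 (t : ℕ) : IsFresh (sys.info t) sys.P (fun ω => (ω t).task2) sys.taskLaw := by
  have h := (sys.isFresh_eval t).nested sys.isFresh_slot_task2 (sys.past_le t)
    Slot.measurable_seed.comap_le
  rwa [MeasurableSpace.comap_comp] at h

end System

/-- The two devices that serve tasks: the mobile device and the MEC server. -/
inductive Device
  | loc
  | mec
  deriving DecidableEq

instance : Fintype Device := ⟨{.loc, .mec}, fun d => by cases d <;> simp⟩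

lemma Device.sum_eq {R : Type*} [AddCommMonoid R] (f : Device → R) :
    ∑ d, f d = f loc + f mec :=
  Finset.sum_pair (by decide)

namespace System

variable (sys : System)

/-- The CPU frequency of a device. -/
def freq : Device → ℝ
  | .loc => sys.fl
  | .mec => sys.fc

/-- The transmission data of a task on a device. -/
def transmission : Device → Task sys.N → ℝ
  | .loc => sys.Dlt
  | .mec => sys.Dct

/-- The number of slots that a task takes on a device. -/
def service : Device → Task sys.N → ℕ
  | .loc => sys.Nl
  | .mec => sys.Nc

/-- The mean transmission data of a task on a device. -/
def meanTransmission (d : Device) : ℝ := ∫ h, sys.transmission d h ∂sys.taskLaw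

/-- The mean number of slots that a task takes on a device. -/
def meanService (d : Device) : ℝ := ∫ h, (sys.service d h : ℝ) ∂sys.taskLaw

/-- The law of the number of slots that a task takes on a device. -/
def serviceLaw (d : Device) : Measure ℕ := sys.taskLaw.map (sys.service d)

instance (d : Device) : IsProbabilityMeasure (sys.serviceLaw d) :=
  Measure.isProbabilityMeasure_map measurable_from_top.aemeasurable

variable (d : Device) (h : Task sys.N)

lemma service_eq : sys.service d h =
    ⌈sys.D h * sys.W / (sys.freq d * sys.Δ) + sys.transmission d h / (sys.R * sys.Δ)⌉₊ := by
  cases d <;> rfl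

lemma freq_pos : 0 < sys.freq d := by
  cases d
  · exact sys.fl_pos
  · exact sys.fc_pos

lemma Dct_nonneg : 0 ≤ sys.Dct h := mul_nonneg sys.τ_pos.le (Nat.cast_nonneg _)

lemma Dlt_nonneg : 0 ≤ sys.Dlt h :=
  mul_nonneg sys.τ_pos.le <| Finset.sum_nonneg fun n _ => by
    unfold G
    split_ifs <;> norm_num

lemma Dlt_le_Dct : sys.Dlt h ≤ sys.Dct h := by
  refine mul_le_mul_of_nonneg_left ?_ sys.τ_pos.le
  calc ∑ n, sys.G h n ≤ ∑ n, if n ∈ h.toFinset then (1 : ℝ) else 0 := by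
        gcongr with n
        unfold G
        simp only [List.mem_toFinset]
        split_ifs <;> simp_all
    _ = h.toFinset.card := by
        rw [Finset.sum_ite_mem, Finset.univ_inter, Finset.sum_const, nsmul_one]
    _ ≤ h.length := Nat.cast_le.2 h.toFinset_card_le

lemma transmission_nonneg : 0 ≤ sys.transmission d h := by
  cases d
  · exact sys.Dlt_nonneg h
  · exact sys.Dct_nonneg h

lemma transmission_le : sys.transmission d h ≤ sys.τ * h.length := by
  cases d
  · exact sys.Dlt_le_Dct h
  · exact le_rfl

lemma memLp_length : MemLp (fun h : Task sys.N => (h.length : ℝ)) 2 sys.taskLaw :=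
  (memLp_two_iff_integrable_sq measurable_from_top.aestronglyMeasurable).2 sys.integrable_sq

lemma integrable_transmission : Integrable (sys.transmission d) sys.taskLaw :=
  ((sys.memLp_length.integrable one_le_two).const_mul sys.τ).mono'
    measurable_from_top.aestronglyMeasurable <| ae_of_all _ fun h => by
      rw [Real.norm_of_nonneg (sys.transmission_nonneg d h)]
      exact sys.transmission_le d h

lemma meanTransmission_nonneg : 0 ≤ sys.meanTransmission d :=
  integral_nonneg (sys.transmission_nonneg d)

lemma meanDlt_le_meanDct : sys.meanDlt ≤ sys.meanDct :=
  integral_mono (sys.integrable_transmission .loc) (sys.integrable_transmission .mec)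
    sys.Dlt_le_Dct

lemma service_le : (sys.service d h : ℝ) ≤
    (sys.τ * sys.W / (sys.freq d * sys.Δ) + sys.τ / (sys.R * sys.Δ)) * h.length + 1 := by
  have := sys.τ_pos
  have := sys.W_pos
  have := sys.R_pos
  have := sys.Δ_pos
  have := sys.freq_pos d
  have h_trans := sys.transmission_nonneg d h
  have h_time : 0 ≤ sys.D h * sys.W / (sys.freq d * sys.Δ) +
      sys.transmission d h / (sys.R * sys.Δ) := by
    unfold D
    positivity
  rw [service_eq]
  calc _ ≤ sys.D h * sys.W / (sys.freq d * sys.Δ) +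
        sys.transmission d h / (sys.R * sys.Δ) + 1 := (Nat.ceil_lt_add_one h_time).le
    _ ≤ sys.D h * sys.W / (sys.freq d * sys.Δ) +
        sys.τ * h.length / (sys.R * sys.Δ) + 1 := by
      gcongr
      exact sys.transmission_le d h
    _ = _ := by
      unfold D
      ring

lemma memLp_service : MemLp (fun h => (sys.service d h : ℝ)) 2 sys.taskLaw :=
  ((sys.memLp_length.const_mul _).add (memLp_const 1)).mono'
    measurable_from_top.aestronglyMeasurable <| ae_of_all _ fun h => by
      rw [Real.norm_natCast]
      exact sys.service_le d h

lemma ae_one_le_service : ∀ᵐ h ∂sys.taskLaw, 1 ≤ sys.service d h := by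
  filter_upwards [sys.ae_ne_nil] with h hh
  have := sys.W_pos
  have := sys.R_pos
  have := sys.Δ_pos
  have := sys.freq_pos d
  have h_trans := sys.transmission_nonneg d h
  have h_size : 0 < sys.D h :=
    mul_pos sys.τ_pos (Nat.cast_pos.2 (List.length_pos_of_ne_nil hh))
  rw [service_eq, Nat.one_le_ceil_iff]
  positivity

lemma memLp_serviceLaw : MemLp (fun k : ℕ => (k : ℝ)) 2 (sys.serviceLaw d) :=
  (memLp_map_measure_iff measurable_from_nat.aestronglyMeasurable
    measurable_from_top.aemeasurable).2 (sys.memLp_service d)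

lemma integral_serviceLaw : ∫ k : ℕ, (k : ℝ) ∂sys.serviceLaw d = sys.meanService d :=
  integral_map measurable_from_top.aemeasurable measurable_from_nat.aestronglyMeasurable

lemma one_le_meanService : 1 ≤ sys.meanService d := by
  have h_one : ∫ _, (1 : ℝ) ∂sys.taskLaw ≤ sys.meanService d :=
    integral_mono_ae (integrable_const 1) ((sys.memLp_service d).integrable one_le_two)
      ((sys.ae_one_le_service d).mono fun h hh => Nat.one_le_cast.2 hh)
  simpa using h_one

lemma meanService_pos : 0 < sys.meanService d := one_pos.trans_le (sys.one_le_meanService d)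

end System

namespace Decision

/-- The number of tasks that are started on a device. -/
def starts (u : Decision) : Device → ℕ
  | .loc => u.ul1 + u.ul2
  | .mec => u.uc1 + u.uc2

/-- Whether it is the second task of the slot that is started on a device. -/
def second (u : Decision) : Device → ℕ
  | .loc => u.ul2
  | .mec => u.uc2

/-- The task of a slot that is started on a device; it is the first one if none is started. -/
def task {N : ℕ} (u : Decision) (d : Device) (x : Slot N) : Task N :=
  if u.second d = 1 then x.task2 else x.task1

lemma starts_le_one (u : Decision) (d : Device) : u.starts d ≤ 1 := by
  cases u <;> cases d <;> simp [starts, ul1, ul2, uc1, uc2]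

end Decision

namespace State

/-- The number of slots during which a device remains busy. -/
def residual (s : State) : Device → ℕ
  | .loc => s.Sl
  | .mec => s.Sc

variable {s : State} {u : Decision}

lemma sum_starts_le (h : u ∈ s.allowed) : ∑ d, u.starts d ≤ s.Q := by
  unfold allowed at h
  cases u <;> split_ifs at h <;>
    simp_all [Device.sum_eq, Decision.starts, Decision.ul1, Decision.ul2, Decision.uc1,
      Decision.uc2] <;>
    omega

lemma residual_eq_zero (h : u ∈ s.allowed) {d : Device} (hd : u.starts d = 1) :
    s.residual d = 0 := by
  unfold allowed at h
  cases u <;> cases d <;> split_ifs at h <;>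
    simp_all [residual, Decision.starts, Decision.ul1, Decision.ul2, Decision.uc1, Decision.uc2]

end State

namespace System

variable {sys : System} (s : State) (u : Decision) (x : Slot sys.N)

lemma Q_next : (sys.next s u x).Q = s.Q - ∑ d, u.starts d + x.A := by
  simp only [next, Device.sum_eq, Decision.starts, add_assoc]

lemma residual_next (d : Device) : (sys.next s u x).residual d =
    if u.starts d = 1 then sys.service d (u.task d x) - 1 else s.residual d - 1 := by
  cases u <;> cases d <;> simp [next, State.residual, service, Decision.starts, Decision.task,
    Decision.second, Decision.ul1, Decision.ul2, Decision.uc1, Decision.uc2]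

namespace Policy

variable (π : sys.Policy)

/-- The queue length at time `t`. -/
def Q (t : ℕ) (ω : sys.Path) : ℕ := (sys.state π.act ω t).Q

/-- The number of slots during which a device remains busy at time `t`. -/
def residual (d : Device) (t : ℕ) (ω : sys.Path) : ℕ := (sys.state π.act ω t).residual d

/-- The number of tasks that are started on a device in slot `t`. -/
def starts (d : Device) (t : ℕ) (ω : sys.Path) : ℕ := (π.act t ω).starts d

/-- The task that a device starts in slot `t`, if it starts any. -/
def task (d : Device) (t : ℕ) (ω : sys.Path) : Task sys.N := (π.act t ω).task d (ω t)

lemma data_eq (t : ℕ) (ω : sys.Path) :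
    π.data t ω = ∑ d, (π.starts d t ω : ℝ) * sys.transmission d (π.task d t ω) := by
  simp only [Device.sum_eq, data, starts, task]
  cases π.act t ω <;> simp [transmission, Decision.starts, Decision.task, Decision.second,
    Decision.ul1, Decision.ul2, Decision.uc1, Decision.uc2, add_comm]

lemma data_nonneg (t : ℕ) (ω : sys.Path) : 0 ≤ π.data t ω := by
  rw [data_eq]
  exact Finset.sum_nonneg fun d _ =>
    mul_nonneg (Nat.cast_nonneg _) (sys.transmission_nonneg d _)

lemma Q_succ (t : ℕ) (ω : sys.Path) :
    (π.Q (t + 1) ω : ℝ) = π.Q t ω - ∑ d, (π.starts d t ω : ℝ) + (ω t).A := by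
  have h_le : ∑ d, π.starts d t ω ≤ π.Q t ω := State.sum_starts_le (π.act_mem t ω)
  rw [← Nat.cast_sum, ← Nat.cast_sub h_le, ← Nat.cast_add]
  exact congrArg Nat.cast (Q_next _ _ _)

lemma residual_succ (d : Device) (t : ℕ) (ω : sys.Path) : π.residual d (t + 1) ω =
    if π.starts d t ω = 1 then sys.service d (π.task d t ω) - 1 else π.residual d t ω - 1 :=
  residual_next _ _ _ d

lemma measurable_starts (d : Device) (t : ℕ) : Measurable[sys.info t] (π.starts d t) :=
  (measurable_from_top (f := fun u : Decision => u.starts d)).comp (π.measurable_act t)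

lemma measurableSet_second (d : Device) (t : ℕ) :
    MeasurableSet[sys.info t] {ω | (π.act t ω).second d = 1} :=
  π.measurable_act t (show MeasurableSet {u : Decision | u.second d = 1} from trivial)

lemma measurable_task (d : Device) (t : ℕ) : Measurable[sys.preArrival t] (π.task d t) := by
  have h_rest : Measurable[sys.preArrival t] fun ω : sys.Path => (ω t).rest :=
    (comap_measurable fun ω : sys.Path => (ω t).rest).mono le_sup_right le_rfl
  exact .ite (sys.info_le_preArrival t _ (π.measurableSet_second d t))
    ((measurable_fst.comp measurable_snd).comp h_rest) (measurable_fst.comp h_rest)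

lemma measurable_residual_succ {d : Device} {t : ℕ} (h : Measurable[sys.past t] (π.residual d t)) :
    Measurable[sys.preArrival t] (π.residual d (t + 1)) := by
  rw [show π.residual d (t + 1) = _ from funext (π.residual_succ d t)]
  refine .ite ?_ ?_ ?_
  · exact sys.info_le_preArrival t _ (π.measurable_starts d t (measurableSet_singleton 1))
  · exact (measurable_from_top (f := fun h => sys.service d h - 1)).comp (π.measurable_task d t)
  · exact (measurable_from_nat (f := fun k : ℕ => k - 1)).comp (h.mono le_sup_left le_rfl)

lemma measurable_residual (d : Device) (t : ℕ) : Measurable[sys.past t] (π.residual d t) := by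
  induction t with
  | zero =>
    unfold residual state
    exact measurable_const
  | succ t ih => exact (π.measurable_residual_succ ih).mono (sys.preArrival_le_past_succ t) le_rfl

lemma isFresh_task (d : Device) (t : ℕ) :
    IsFresh (sys.info t) sys.P (π.task d t) sys.taskLaw :=
  (sys.isFresh_task2 t).ite (sys.isFresh_task1 t) (sys.info_le t) (π.measurableSet_second d t)

lemma server (d : Device) : Server sys.info sys.P (sys.serviceLaw d) (π.starts d)
    (fun t ω => sys.service d (π.task d t ω)) (π.residual d) where
  le := sys.info_le
  u_le_one _ _ := Decision.starts_le_one _ d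
  idle t ω := State.residual_eq_zero (π.act_mem t ω)
  S_zero _ := by cases d <;> rfl
  S_succ := π.residual_succ d
  measurable_u := π.measurable_starts d
  measurable_S t := (π.measurable_residual d t).mono (sys.past_le_info t) le_rfl
  isFresh t := (π.isFresh_task d t).comp measurable_from_top
  memLp := sys.memLp_serviceLaw d

lemma measurable_Q (t : ℕ) : Measurable[sys.past t] fun ω => (π.Q t ω : ℝ) := by
  induction t with
  | zero =>
    unfold Q state
    exact measurable_const
  | succ t ih =>
    have h_starts (d : Device) : Measurable[sys.past (t + 1)] fun ω => (π.starts d t ω : ℝ) :=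
      ((π.server d).measurable_cast_u t).mono
        ((sys.info_le_preArrival t).trans (sys.preArrival_le_past_succ t)) le_rfl
    have h_arrival : Measurable[sys.past (t + 1)] fun ω => ((ω t).A : ℝ) :=
      measurable_from_nat.comp (Slot.measurable_A.comp (sys.measurable_eval t))
    simp only [Q_succ]
    exact ((ih.mono (sys.past_mono t.le_succ) le_rfl).sub
      (Finset.measurable_fun_sum _ fun d _ => h_starts d)).add h_arrival

lemma integrable_arrival (t : ℕ) : Integrable (fun ω : sys.Path => ((ω t).A : ℝ)) sys.P :=
  (sys.isFresh_A t).measurePreserving.integrable_comp_of_integrable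
    (sys.memLp_arrivalLaw.integrable one_le_two)

lemma integrable_sum_starts (t : ℕ) :
    Integrable (fun ω => ∑ d, (π.starts d t ω : ℝ)) sys.P :=
  integrable_finsetSum _ fun d _ => (π.server d).integrable_u t

lemma integrable_Q (t : ℕ) : Integrable (fun ω => (π.Q t ω : ℝ)) sys.P := by
  induction t with
  | zero => simp [Q, state]
  | succ t ih =>
    simp only [Q_succ]
    exact (ih.sub (π.integrable_sum_starts t)).add (integrable_arrival t)

lemma integral_Q (T : ℕ) : ∫ ω, (π.Q T ω : ℝ) ∂sys.P =
    sys.lam * T - ∑ d, ∑ t ∈ Finset.range T, ∫ ω, (π.starts d t ω : ℝ) ∂sys.P := by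
  induction T with
  | zero => simp [Q, state]
  | succ T ih =>
    have h_sub : Integrable (fun ω => (π.Q T ω : ℝ) - ∑ d, (π.starts d T ω : ℝ)) sys.P :=
      (π.integrable_Q T).sub (π.integrable_sum_starts T)
    have h_arrival : ∫ ω, ((ω T).A : ℝ) ∂sys.P = sys.lam :=
      ((sys.isFresh_A T).integral_comp measurable_from_nat).trans sys.integral_arrivalLaw
    simp only [Q_succ, Finset.sum_range_succ, Finset.sum_add_distrib]
    rw [integral_add h_sub (integrable_arrival T),
      integral_sub (π.integrable_Q T) (π.integrable_sum_starts T),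
      integral_finsetSum _ fun d _ => (π.server d).integrable_u T, ih, h_arrival]
    push_cast
    ring

lemma lintegral_sum_Q (T : ℕ) :
    ∫⁻ ω, ∑ t ∈ Finset.range T, ((sys.state π.act ω t).Q : ℝ≥0∞) ∂sys.P =
      ENNReal.ofReal (∑ t ∈ Finset.range T, ∫ ω, (π.Q t ω : ℝ) ∂sys.P) := by
  rw [← integral_finsetSum _ fun t _ => π.integrable_Q t, ofReal_integral_eq_lintegral_ofReal
    (integrable_finsetSum _ fun t _ => π.integrable_Q t)
    (ae_of_all _ fun ω => Finset.sum_nonneg fun t _ => Nat.cast_nonneg _)]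
  refine lintegral_congr fun ω => ?_
  rw [← Nat.cast_sum, ← Nat.cast_sum, ENNReal.ofReal_natCast]
  rfl

lemma integrable_starts_mul_transmission (d : Device) (t : ℕ) :
    Integrable (fun ω => (π.starts d t ω : ℝ) * sys.transmission d (π.task d t ω)) sys.P :=
  ((π.isFresh_task d t).indepFun ((π.server d).measurable_cast_u t)
    measurable_from_top).integrable_mul ((π.server d).integrable_u t)
    ((π.isFresh_task d t).measurePreserving.integrable_comp_of_integrable
      (sys.integrable_transmission d))

lemma integrable_data (t : ℕ) : Integrable (π.data t) sys.P := by
  rw [show π.data t = _ from funext (π.data_eq t)]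
  exact integrable_finsetSum _ fun d _ => π.integrable_starts_mul_transmission d t

lemma integral_data (t : ℕ) : ∫ ω, π.data t ω ∂sys.P =
    ∑ d, (∫ ω, (π.starts d t ω : ℝ) ∂sys.P) * sys.meanTransmission d := by
  simp only [data_eq]
  rw [integral_finsetSum _ fun d _ => π.integrable_starts_mul_transmission d t]
  exact Finset.sum_congr rfl fun d _ => (π.isFresh_task d t).integral_mul (sys.info_le t)
    ((π.server d).measurable_cast_u t) measurable_from_top

lemma lintegral_sum_data (T : ℕ) :
    ∫⁻ ω, ENNReal.ofReal (∑ t ∈ Finset.range T, π.data t ω) ∂sys.P = ENNReal.ofReal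
      (∑ d, (∑ t ∈ Finset.range T, ∫ ω, (π.starts d t ω : ℝ) ∂sys.P) *
        sys.meanTransmission d) := by
  rw [← ofReal_integral_eq_lintegral_ofReal (integrable_finsetSum _ fun t _ => π.integrable_data t)
    (ae_of_all _ fun ω => Finset.sum_nonneg fun t _ => π.data_nonneg t ω),
    integral_finsetSum _ fun t _ => π.integrable_data t]
  simp only [integral_data, Finset.sum_mul]
  rw [Finset.sum_comm]

end Policy

end System

namespace System

variable (sys : System)

lemma coe_lam_pos : (0 : ℝ) < sys.lam := sys.lam_pos

/-- The rate at which the two devices can serve tasks when both are busy all the time. -/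
def capacity : ℝ := ∑ d, 1 / sys.meanService d

/-- The mean transmission data per task when the mobile device is busy all the time and the MEC
server takes the remaining tasks. -/
def saturatedData : ℝ :=
  sys.meanDct - 1 / ((sys.lam : ℝ) * sys.meanNl) * (sys.meanDct - sys.meanDlt)

lemma capacity_eq : sys.capacity = 1 / sys.meanNl + 1 / sys.meanNc := Device.sum_eq _

namespace Policy

variable {sys} (π : sys.Policy)

/-- The expected number of tasks per slot that are started on a device before time `T`. -/
def startRate (d : Device) (T : ℕ) : ℝ :=
  (∑ t ∈ Finset.range T, ∫ ω, (π.starts d t ω : ℝ) ∂sys.P) / T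

/-- The expected number of tasks per slot that arrive before time `T` and are still queued. -/
def queueRate (T : ℕ) : ℝ := (∫ ω, (π.Q T ω : ℝ) ∂sys.P) / T

/-- The expected transmission data before time `T`, divided by the expected number of
arrivals. -/
def dataPerTask (T : ℕ) : ℝ := (∑ d, π.startRate d T * sys.meanTransmission d) / sys.lam

lemma startRate_nonneg (d : Device) (T : ℕ) : 0 ≤ π.startRate d T :=
  div_nonneg (Finset.sum_nonneg fun _ _ => integral_nonneg fun _ => Nat.cast_nonneg _)
    (Nat.cast_nonneg _)

lemma sum_startRate {T : ℕ} (hT : T ≠ 0) : ∑ d, π.startRate d T = sys.lam - π.queueRate T := by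
  simp only [startRate, queueRate]
  rw [integral_Q, ← Finset.sum_div]
  field_simp
  ring

lemma exists_startRate_le (d : Device) : ∃ r : ℕ → ℝ,
    Tendsto r atTop (nhds (1 / sys.meanService d)) ∧ ∀ T, π.startRate d T ≤ r T := by
  rw [← integral_serviceLaw]
  exact (π.server d).exists_tendsto_rate_le
    ((sys.meanService_pos d).trans_eq (sys.integral_serviceLaw d).symm)

lemma avgData_eq_limsup :
    π.avgData = limsup (fun T => ENNReal.ofReal (π.dataPerTask T)) atTop := by
  refine limsup_congr ((eventually_gt_atTop 0).mono fun T hT => ?_)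
  rw [lintegral_sum_data,
    ← ENNReal.ofReal_div_of_pos (mul_pos sys.coe_lam_pos (Nat.cast_pos.2 hT)), dataPerTask]
  simp only [startRate, div_mul_eq_mul_div, ← Finset.sum_div, div_div, mul_comm (sys.lam : ℝ)]

lemma ofReal_le_avgData {φ : ℕ → ℕ} (hφ : Tendsto φ atTop atTop) {ℓ : ℕ → ℝ} {L : ℝ}
    (hℓ : Tendsto ℓ atTop (nhds L)) (h : ∀ᶠ k in atTop, ℓ k ≤ π.dataPerTask (φ k)) :
    ENNReal.ofReal L ≤ π.avgData := by
  rw [avgData_eq_limsup, ← (ENNReal.tendsto_ofReal hℓ).limsup_eq]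
  refine (limsup_le_limsup (h.mono fun k hk => ENNReal.ofReal_le_ofReal hk)).trans ?_
  rw [show (fun k => ENNReal.ofReal (π.dataPerTask (φ k))) =
    (fun T => ENNReal.ofReal (π.dataPerTask T)) ∘ φ from rfl, limsup_comp]
  exact limsup_le_limsup_of_le hφ

lemma avgData_le_of_startRate_le {r : Device → ℕ → ℝ} {x : Device → ℝ}
    (hr : ∀ d, Tendsto (r d) atTop (nhds (x d))) (h : ∀ d T, π.startRate d T ≤ r d T) :
    π.avgData ≤ ENNReal.ofReal ((∑ d, x d * sys.meanTransmission d) / sys.lam) := by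
  have h_lim : Tendsto (fun T => (∑ d, r d T * sys.meanTransmission d) / sys.lam) atTop
      (nhds ((∑ d, x d * sys.meanTransmission d) / sys.lam)) :=
    (tendsto_finsetSum _ fun d _ => (hr d).mul_const _).div_const _
  rw [avgData_eq_limsup, ← (ENNReal.tendsto_ofReal h_lim).limsup_eq]
  refine limsup_le_limsup (.of_forall fun T => ENNReal.ofReal_le_ofReal ?_)
  have := sys.coe_lam_pos
  unfold dataPerTask
  gcongr with d
  · exact sys.meanTransmission_nonneg d
  · exact h d T

lemma avgData_le_saturatedData (h : (sys.lam : ℝ) = sys.capacity) :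
    π.avgData ≤ ENNReal.ofReal sys.saturatedData := by
  choose r hr hle using π.exists_startRate_le
  refine (π.avgData_le_of_startRate_le hr hle).trans_eq ?_
  have h_lam := sys.coe_lam_pos
  have h_loc : 0 < sys.meanNl := sys.meanService_pos .loc
  have h_mec : 0 < sys.meanNc := sys.meanService_pos .mec
  rw [capacity_eq] at h
  have h_sum : ∑ d, 1 / sys.meanService d * sys.meanTransmission d =
    1 / sys.meanNl * sys.meanDlt + 1 / sys.meanNc * sys.meanDct := Device.sum_eq _
  congr 1
  rw [h_sum, saturatedData, div_eq_iff h_lam.ne', ← sub_eq_of_eq_add' h]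
  field_simp
  ring

variable {π}

lemma mem_feasible_of_sum_integral_Q_le {C : ℝ}
    (h : ∀ T : ℕ, ∑ t ∈ Finset.range T, ∫ ω, (π.Q t ω : ℝ) ∂sys.P ≤ C * T) :
    π ∈ sys.feasible := by
  refine lt_of_le_of_lt (b := ENNReal.ofReal C) ?_ ENNReal.ofReal_lt_top
  refine limsup_le_of_le (h := ?_)
  filter_upwards [eventually_gt_atTop 0] with T hT
  have hT' : (0 : ℝ) < T := Nat.cast_pos.2 hT
  rw [lintegral_sum_Q, ← ENNReal.ofReal_natCast, ← ENNReal.ofReal_div_of_pos hT']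
  exact ENNReal.ofReal_le_ofReal ((div_le_iff₀ hT').2 (h T))

lemma exists_eventually_sum_integral_Q_le (hπ : π ∈ sys.feasible) : ∃ C : ℝ, ∀ᶠ T : ℕ in atTop,
    ∑ t ∈ Finset.range T, ∫ ω, (π.Q t ω : ℝ) ∂sys.P ≤ C * T := by
  obtain ⟨c, hc, hc_top⟩ := exists_between (show π.avgQueue < ⊤ from hπ)
  refine ⟨c.toReal, ?_⟩
  filter_upwards [eventually_lt_of_limsup_lt hc, eventually_gt_atTop 0] with T hT hT₀
  have hT₀' : (0 : ℝ) < T := Nat.cast_pos.2 hT₀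
  rw [lintegral_sum_Q, ← ENNReal.ofReal_natCast, ← ENNReal.ofReal_div_of_pos hT₀',
    ← ENNReal.ofReal_toReal hc_top.ne] at hT
  exact ((div_lt_iff₀ hT₀').1 (ENNReal.ofReal_lt_ofReal_iff'.1 hT).1).le

lemma exists_strictMono_tendsto_queueRate (hπ : π ∈ sys.feasible) :
    ∃ φ : ℕ → ℕ, StrictMono φ ∧ Tendsto (fun k => π.queueRate (φ k)) atTop (nhds 0) := by
  obtain ⟨C, hC⟩ := exists_eventually_sum_integral_Q_le hπ
  exact exists_strictMono_tendsto_div_zero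
    (fun t => integral_nonneg fun ω => Nat.cast_nonneg (π.Q t ω)) hC

lemma lam_le_capacity (hπ : π ∈ sys.feasible) : (sys.lam : ℝ) ≤ sys.capacity := by
  obtain ⟨φ, hφ, hφ_lim⟩ := exists_strictMono_tendsto_queueRate hπ
  choose r hr hle using π.exists_startRate_le
  have h_starts : Tendsto (fun k => sys.lam - π.queueRate (φ k)) atTop (nhds (sys.lam : ℝ)) := by
    simpa using hφ_lim.const_sub (sys.lam : ℝ)
  refine le_of_tendsto_of_tendsto h_starts
    (tendsto_finsetSum _ fun d _ => (hr d).comp hφ.tendsto_atTop) ?_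
  filter_upwards [hφ.tendsto_atTop.eventually_ne_atTop 0] with k hk
  rw [← π.sum_startRate hk]
  exact Finset.sum_le_sum fun d _ => hle d (φ k)

lemma meanDlt_le_avgData (hπ : π ∈ sys.feasible) : ENNReal.ofReal sys.meanDlt ≤ π.avgData := by
  obtain ⟨φ, hφ, hφ_lim⟩ := exists_strictMono_tendsto_queueRate hπ
  have h_lam := sys.coe_lam_pos
  have h_lim : Tendsto (fun k => (sys.lam - π.queueRate (φ k)) * sys.meanDlt / sys.lam) atTop
      (nhds sys.meanDlt) := by
    have := ((hφ_lim.const_sub (sys.lam : ℝ)).mul_const sys.meanDlt).div_const (sys.lam : ℝ)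
    rwa [sub_zero, mul_div_cancel_left₀ _ h_lam.ne'] at this
  refine π.ofReal_le_avgData hφ.tendsto_atTop h_lim ?_
  filter_upwards [hφ.tendsto_atTop.eventually_ne_atTop 0] with k hk
  rw [← π.sum_startRate hk, Finset.sum_mul, dataPerTask]
  gcongr with d
  · exact π.startRate_nonneg d _
  · cases d
    exacts [le_rfl, sys.meanDlt_le_meanDct]

lemma saturatedData_le_avgData (hπ : π ∈ sys.feasible) :
    ENNReal.ofReal sys.saturatedData ≤ π.avgData := by
  obtain ⟨φ, hφ, hφ_lim⟩ := exists_strictMono_tendsto_queueRate hπ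
  obtain ⟨r, hr, hle⟩ := π.exists_startRate_le .loc
  have h_lam := sys.coe_lam_pos
  have h_diff : 0 ≤ sys.meanDct - sys.meanDlt := sub_nonneg.2 sys.meanDlt_le_meanDct
  have h_lim : Tendsto (fun k => ((sys.lam - π.queueRate (φ k)) * sys.meanDct -
      r (φ k) * (sys.meanDct - sys.meanDlt)) / sys.lam) atTop (nhds sys.saturatedData) := by
    have h_value : sys.saturatedData = ((sys.lam - 0) * sys.meanDct -
        1 / sys.meanNl * (sys.meanDct - sys.meanDlt)) / sys.lam := by
      unfold saturatedData
      field_simp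
      ring
    rw [h_value]
    exact (((hφ_lim.const_sub (sys.lam : ℝ)).mul_const sys.meanDct).sub
      ((hr.comp hφ.tendsto_atTop).mul_const (sys.meanDct - sys.meanDlt))).div_const _
  refine π.ofReal_le_avgData hφ.tendsto_atTop h_lim ?_
  filter_upwards [hφ.tendsto_atTop.eventually_ne_atTop 0] with k hk
  have h_data : ∑ d, π.startRate d (φ k) * sys.meanTransmission d =
      π.startRate .loc (φ k) * sys.meanDlt + π.startRate .mec (φ k) * sys.meanDct :=
    Device.sum_eq _
  rw [← π.sum_startRate hk, Device.sum_eq, dataPerTask, h_data]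
  gcongr
  linarith [mul_le_mul_of_nonneg_right (hle (φ k)) h_diff]

end Policy

end System

namespace System

variable (sys : System)

/-- The filtration of the slots before slot `t`. -/
def pastFiltration : Filtration ℕ (MeasurableSpace.pi : MeasurableSpace sys.Path) where
  seq := sys.past
  mono' := sys.past_mono
  le' := sys.past_le

namespace Policy

variable {sys} (π : sys.Policy)

/-- The load: the number of queued tasks plus the residual work on the devices, measured in mean
service times. -/
def load (t : ℕ) (ω : sys.Path) : ℝ := π.Q t ω + ∑ d, (π.residual d t ω : ℝ) / sys.meanService d

/-- The noise in the evolution of the load: the deviations of the arrival and of the service times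
of the tasks that are started from their means. -/
def noise (t : ℕ) (ω : sys.Path) : ℝ := ((ω t).A - sys.lam) + ∑ d,
  π.starts d t ω / sys.meanService d * (sys.service d (π.task d t ω) - sys.meanService d)

lemma load_nonneg (t : ℕ) (ω : sys.Path) : 0 ≤ π.load t ω :=
  add_nonneg (Nat.cast_nonneg _) <| Finset.sum_nonneg fun d _ =>
    div_nonneg (Nat.cast_nonneg _) (sys.meanService_pos d).le

lemma measurable_load (t : ℕ) : Measurable[sys.past t] (π.load t) :=
  (π.measurable_Q t).add <| Finset.measurable_fun_sum _ fun d _ =>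
    (measurable_from_nat.comp (π.measurable_residual d t)).div_const _

lemma integrable_load (t : ℕ) : Integrable (π.load t) sys.P :=
  (π.integrable_Q t).add <| integrable_finsetSum _ fun d _ =>
    ((π.server d).integrable_S t).div_const _

lemma measurable_load_succ_sub (t : ℕ) :
    Measurable[sys.preArrival t] fun ω => π.load (t + 1) ω - π.load t ω - (ω t).A := by
  have h_starts (d : Device) : Measurable[sys.preArrival t] fun ω => (π.starts d t ω : ℝ) :=
    ((π.server d).measurable_cast_u t).mono (sys.info_le_preArrival t) le_rfl
  have h_residual (d : Device) :
      Measurable[sys.preArrival t] fun ω => (π.residual d (t + 1) ω : ℝ) :=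
    measurable_from_nat.comp (π.measurable_residual_succ (π.measurable_residual d t))
  have h_eq : (fun ω => π.load (t + 1) ω - π.load t ω - (ω t).A) = fun ω =>
      π.Q t ω - ∑ d, (π.starts d t ω : ℝ) +
        ∑ d, (π.residual d (t + 1) ω : ℝ) / sys.meanService d - π.load t ω := by
    funext ω
    rw [load, Q_succ]
    ring
  rw [h_eq]
  exact ((((π.measurable_Q t).mono le_sup_left le_rfl).sub
    (Finset.measurable_fun_sum _ fun d _ => h_starts d)).add
    (Finset.measurable_fun_sum _ fun d _ => (h_residual d).div_const _)).sub
    ((π.measurable_load t).mono le_sup_left le_rfl)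

lemma load_add_noise_le (h : sys.capacity ≤ sys.lam) (t : ℕ) (ω : sys.Path) :
    π.load t ω + π.noise t ω ≤ π.load (t + 1) ω := by
  have h_device (d : Device) : (π.residual d t ω : ℝ) / sys.meanService d +
      π.starts d t ω / sys.meanService d * (sys.service d (π.task d t ω) - sys.meanService d) ≤
      π.residual d (t + 1) ω / sys.meanService d + 1 / sys.meanService d - π.starts d t ω := by
    have h_pos := sys.meanService_pos d
    have h_step : (π.residual d t ω : ℝ) + π.starts d t ω * sys.service d (π.task d t ω) ≤
        π.residual d (t + 1) ω + 1 := by exact_mod_cast (π.server d).add_mul_le_succ t ω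
    calc _ = (π.residual d t ω + π.starts d t ω * sys.service d (π.task d t ω)) /
          sys.meanService d - π.starts d t ω := by
          field_simp
          ring
      _ ≤ (π.residual d (t + 1) ω + 1) / sys.meanService d - π.starts d t ω := by gcongr
      _ = _ := by rw [add_div]
  have h_sum := Finset.sum_le_sum fun d (_ : d ∈ Finset.univ) => h_device d
  rw [Finset.sum_add_distrib, Finset.sum_sub_distrib, Finset.sum_add_distrib] at h_sum
  rw [load, load, noise, Q_succ]
  unfold capacity at h
  linarith

lemma integrable_starts_mul_service_sub (d : Device) (t : ℕ) :
    Integrable (fun ω => π.starts d t ω / sys.meanService d *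
      (sys.service d (π.task d t ω) - sys.meanService d)) sys.P := by
  have h_service :
      MemLp (fun ω => (sys.service d (π.task d t ω) : ℝ) - sys.meanService d) 2 sys.P :=
    ((π.server d).memLp_n t).sub (memLp_const _)
  simp only [div_mul_eq_mul_div]
  exact (((π.server d).memLp_u t).integrable_mul h_service).div_const _

lemma integrable_noise (t : ℕ) : Integrable (π.noise t) sys.P :=
  ((integrable_arrival t).sub (integrable_const _)).add <|
    integrable_finsetSum _ fun d _ => π.integrable_starts_mul_service_sub d t

lemma setIntegral_noise (t : ℕ) {s : Set sys.Path} (hs : MeasurableSet[sys.past t] s) :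
    ∫ ω in s, π.noise t ω ∂sys.P = 0 := by
  have h_arrival : ∫ ω in s, ((ω t).A - sys.lam : ℝ) ∂sys.P = 0 := by
    have := (sys.isFresh_A t).setIntegral_mul_sub_integral (g := fun _ => 1)
      (f := fun k : ℕ => (k : ℝ)) ((sys.preArrival_le_past_succ t).trans (sys.past_le _))
      measurable_const measurable_from_nat (sys.memLp_arrivalLaw.integrable one_le_two)
      (le_sup_left (a := sys.past t) s hs)
    simpa only [one_mul, integral_arrivalLaw] using this
  have h_service (d : Device) : ∫ ω in s, π.starts d t ω / sys.meanService d *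
      (sys.service d (π.task d t ω) - sys.meanService d) ∂sys.P = 0 := by
    have := ((π.server d).isFresh t).setIntegral_mul_sub_integral (f := fun k : ℕ => (k : ℝ))
      (sys.info_le t) (((π.server d).measurable_cast_u t).div_const (sys.meanService d))
      measurable_from_nat ((sys.memLp_serviceLaw d).integrable one_le_two)
      (sys.past_le_info t s hs)
    simpa only [integral_serviceLaw] using this
  have h_integrable_arrival : Integrable (fun ω => ((ω t).A - sys.lam : ℝ)) sys.P :=
    (integrable_arrival t).sub (integrable_const _)
  have h_integrable_service (d : Device) := π.integrable_starts_mul_service_sub d t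
  unfold noise
  rw [integral_add h_integrable_arrival.integrableOn
    (integrable_finsetSum _ fun d _ => h_integrable_service d).integrableOn,
    integral_finsetSum _ fun d _ => (h_integrable_service d).integrableOn,
    h_arrival, Finset.sum_eq_zero fun d _ => h_service d, add_zero]

lemma submartingale_load (h : sys.capacity ≤ sys.lam) :
    Submartingale π.load sys.pastFiltration sys.P := by
  refine submartingale_of_setIntegral_le_succ (fun t => (π.measurable_load t).stronglyMeasurable)
    π.integrable_load fun t s hs => ?_
  calc ∫ ω in s, π.load t ω ∂sys.P = ∫ ω in s, (π.load t ω + π.noise t ω) ∂sys.P := by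
        rw [integral_add (π.integrable_load t).integrableOn (π.integrable_noise t).integrableOn,
          π.setIntegral_noise t hs, add_zero]
    _ ≤ ∫ ω in s, π.load (t + 1) ω ∂sys.P :=
        integral_mono ((π.integrable_load t).add (π.integrable_noise t)).integrableOn
          (π.integrable_load (t + 1)).integrableOn (π.load_add_noise_le h t)

lemma integral_load_le (t : ℕ) : ∫ ω, π.load t ω ∂sys.P ≤
    ∫ ω, (π.Q t ω : ℝ) ∂sys.P + ∑ d, ∫ ω, (π.residual d t ω : ℝ) ∂sys.P := by
  have h_residual := integrable_finsetSum Finset.univ fun d _ => (π.server d).integrable_S t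
  rw [← integral_finsetSum _ fun d _ => (π.server d).integrable_S t,
    ← integral_add (π.integrable_Q t) h_residual]
  refine integral_mono (π.integrable_load t) ((π.integrable_Q t).add h_residual) fun ω => ?_
  unfold load
  gcongr with d
  exact div_le_self (Nat.cast_nonneg _) (sys.one_le_meanService d)

variable {π}

lemma exists_integral_load_le (hπ : π ∈ sys.feasible) (h : sys.capacity ≤ sys.lam) :
    ∃ R, ∀ t, ∫ ω, π.load t ω ∂sys.P ≤ R := by
  obtain ⟨C, hC⟩ := exists_eventually_sum_integral_Q_le hπ
  refine ⟨_, le_of_monotone_of_sum_le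
    (C := C + ∑ d, ∫ k : ℕ, (k : ℝ) ^ 2 ∂sys.serviceLaw d) (fun s t hst => ?_)
    (fun t => integral_nonneg (π.load_nonneg t)) ?_⟩
  · simpa using (π.submartingale_load h).setIntegral_le hst .univ
  · filter_upwards [hC] with T hT
    calc ∑ t ∈ Finset.range T, ∫ ω, π.load t ω ∂sys.P
        ≤ ∑ t ∈ Finset.range T, (∫ ω, (π.Q t ω : ℝ) ∂sys.P +
          ∑ d, ∫ ω, (π.residual d t ω : ℝ) ∂sys.P) :=
          Finset.sum_le_sum fun t _ => π.integral_load_le t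
      _ = ∑ t ∈ Finset.range T, ∫ ω, (π.Q t ω : ℝ) ∂sys.P +
          ∑ d, ∑ t ∈ Finset.range T, ∫ ω, (π.residual d t ω : ℝ) ∂sys.P := by
          rw [Finset.sum_add_distrib, Finset.sum_comm]
      _ ≤ C * T + ∑ d, T * ∫ k : ℕ, (k : ℝ) ^ 2 ∂sys.serviceLaw d :=
          add_le_add hT (Finset.sum_le_sum fun d _ => (π.server d).sum_integral_S_le T)
      _ = _ := by
          rw [← Finset.mul_sum]
          ring

lemma exists_ae_tendsto_load (hπ : π ∈ sys.feasible) (h : sys.capacity ≤ sys.lam) :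
    ∀ᵐ ω ∂sys.P, ∃ c, Tendsto (fun t => π.load t ω) atTop (nhds c) := by
  obtain ⟨R, hR⟩ := exists_integral_load_le hπ h
  refine (π.submartingale_load h).exists_ae_tendsto_of_bdd (R := R.toNNReal) fun t => ?_
  rw [eLpNorm_one_eq_lintegral_enorm,
    ← ofReal_integral_norm_eq_lintegral_enorm (π.integrable_load t)]
  refine ENNReal.ofReal_le_ofReal ?_
  simpa only [Real.norm_of_nonneg (π.load_nonneg t _)] using hR t

end Policy

variable {sys}

lemma feasible_eq_empty_of_capacity_le (h : sys.capacity ≤ sys.lam) (h_lam : (sys.lam : ℝ) < 1) :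
    sys.feasible = ∅ := by
  refine Set.eq_empty_of_forall_notMem fun π hπ => ?_
  have h_increment : ∀ᵐ ω ∂sys.P,
      Tendsto (fun t => π.load (t + 1) ω - π.load t ω) atTop (nhds 0) := by
    filter_upwards [Policy.exists_ae_tendsto_load hπ h] with ω ⟨c, hc⟩
    simpa using ((tendsto_add_atTop_iff_nat 1).2 hc).sub hc
  have h_measure : TendstoInMeasure sys.P
      (fun t ω => (((ω t).A : ℕ) : ℝ) + (π.load (t + 1) ω - π.load t ω - (ω t).A)) atTop 0 := by
    simp only [add_sub_cancel]
    exact tendstoInMeasure_of_tendsto_ae (fun t =>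
      ((π.integrable_load (t + 1)).sub (π.integrable_load t)).aestronglyMeasurable) h_increment
  exact IsFresh.not_tendstoInMeasure_add (f := fun k : ℕ => (k : ℝ)) sys.isFresh_A
    (fun t => (sys.preArrival_le_past_succ t).trans (sys.past_le _)) π.measurable_load_succ_sub
    sys.arrivalLaw_singleton_one_ne_zero (sys.arrivalLaw_singleton_zero_ne_zero h_lam)
    (by norm_num) h_measure

end System

/-- The fraction of the arrivals that is routed to a device when the mobile device gets the
fraction `p`. -/
def share (p : ℝ) : Device → ℝ
  | .loc => p
  | .mec => 1 - p

lemma share_mix (p q s : ℝ) (d : Device) :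
    share ((1 - s) * p + s * q) d = (1 - s) * share p d + s * share q d := by
  cases d <;> simp only [share]
  ring

/-- The seeds for which an arrival is routed to a device, a set of measure `share p d`. -/
def routeSeeds (p : I) : Device → Set I
  | .loc => Set.Iic p
  | .mec => Set.Ioi p

lemma measurableSet_routeSeeds (p : I) (d : Device) : MeasurableSet (routeSeeds p d) := by
  cases d
  · exact measurableSet_Iic
  · exact measurableSet_Ioi

lemma volume_real_routeSeeds (p : I) (d : Device) : volume.real (routeSeeds p d) = share p d := by
  cases d
  · simp [routeSeeds, share, measureReal_def, p.2.1]
  · simp [routeSeeds, share, measureReal_def, p.2.2]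

namespace Slot

variable {N : ℕ} (p : I)

/-- The number of arrivals of a slot that are routed to a device. -/
def routed (d : Device) (x : Slot N) : ℕ := (routeSeeds p d).indicator 1 x.seed * x.A

lemma sum_routed (x : Slot N) : ∑ d, x.routed p d = x.A := by
  rcases le_or_gt x.seed p with h | h
  · simp [Device.sum_eq, routed, routeSeeds, h]
  · simp [Device.sum_eq, routed, routeSeeds, h, not_le_of_gt h]

lemma measurable_routed (d : Device) : Measurable (routed (N := N) p d) :=
  (((measurable_indicator_const_iff 1).2 (measurableSet_routeSeeds p d)).comp
    measurable_seed).mul measurable_A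

lemma routed_le (d : Device) (x : Slot N) : x.routed p d ≤ x.A :=
  (Finset.single_le_sum (fun _ _ => Nat.zero_le _) (Finset.mem_univ d)).trans_eq (x.sum_routed p)

end Slot

namespace System

variable (sys : System) (p : I) (d : Device)

/-- The law of the number of arrivals in one slot that are routed to a device. -/
def routedLaw : Measure ℕ := sys.slotLaw.map (Slot.routed p d)

lemma memLp_routedLaw : MemLp (fun k : ℕ => (k : ℝ)) 2 (sys.routedLaw p d) := by
  refine (memLp_map_measure_iff measurable_from_nat.aestronglyMeasurable
    (Slot.measurable_routed p d).aemeasurable).2 ?_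
  refine (sys.memLp_arrivalLaw.comp_measurePreserving
    sys.isFresh_slot_A.measurePreserving).mono
    (measurable_from_nat.comp (Slot.measurable_routed p d)).aestronglyMeasurable
    (ae_of_all _ fun x => ?_)
  simpa using Slot.routed_le p d x

lemma integral_routedLaw : ∫ k : ℕ, (k : ℝ) ∂sys.routedLaw p d = sys.lam * share p d := by
  have h_seed : MeasurePreserving Slot.seed sys.slotLaw volume :=
    measurePreserving_snd.comp (measurePreserving_snd.comp sys.measurePreserving_rest)
  have h_indicator : Measurable ((routeSeeds p d).indicator (1 : I → ℝ)) :=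
    measurable_one.indicator (measurableSet_routeSeeds p d)
  have h_rest : Measurable[MeasurableSpace.comap Slot.rest inferInstance]
      fun x : Slot sys.N => (routeSeeds p d).indicator (1 : I → ℝ) x.seed :=
    h_indicator.comp ((measurable_snd.comp measurable_snd).comp (comap_measurable Slot.rest))
  calc ∫ k : ℕ, (k : ℝ) ∂sys.routedLaw p d = ∫ x, (x.routed p d : ℝ) ∂sys.slotLaw :=
        integral_map (Slot.measurable_routed p d).aemeasurable
          measurable_from_nat.aestronglyMeasurable
    _ = ∫ x, (routeSeeds p d).indicator (1 : I → ℝ) x.seed * (x.A : ℝ) ∂sys.slotLaw := by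
        congr with x
        by_cases h : x.seed ∈ routeSeeds p d <;> simp [Slot.routed, h]
    _ = (∫ x, (routeSeeds p d).indicator (1 : I → ℝ) x.seed ∂sys.slotLaw) * sys.lam := by
        rw [sys.isFresh_slot_A.integral_mul (f := fun k : ℕ => (k : ℝ))
          Slot.measurable_rest.comap_le h_rest measurable_from_nat, integral_arrivalLaw]
    _ = (∫ y, (routeSeeds p d).indicator (1 : I → ℝ) y) * sys.lam := by
        rw [← h_seed.map_eq, integral_map h_seed.measurable.aemeasurable
          h_indicator.aestronglyMeasurable]
    _ = sys.lam * share p d := by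
        rw [integral_indicator_one (measurableSet_routeSeeds p d), volume_real_routeSeeds, mul_comm]

end System

/-- The lengths `s.1` of separate queues for the devices, and the numbers `s.2` of slots during
which the devices remain busy. -/
abbrev SplitState : Type := (Device → ℕ) × (Device → ℕ)

namespace SplitState

variable (s : SplitState)

/-- The state with the queues merged. -/
def merge : State := ⟨∑ d, s.1 d, s.2 .loc, s.2 .mec⟩

/-- The decision under which each device starts a task of its own queue whenever possible. -/
def decision : Decision :=
  if s.2 .loc = 0 ∧ 0 < s.1 .loc then
    if s.2 .mec = 0 ∧ 0 < s.1 .mec then .locMec else .loc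
  else if s.2 .mec = 0 ∧ 0 < s.1 .mec then .mec else .none

lemma residual_merge (d : Device) : s.merge.residual d = s.2 d := by
  cases d <;> rfl

lemma starts_decision (d : Device) :
    s.decision.starts d = if s.2 d = 0 ∧ 0 < s.1 d then 1 else 0 := by
  unfold decision
  cases d <;> split_ifs <;> rfl

lemma starts_decision_le (d : Device) : s.decision.starts d ≤ s.1 d := by
  rw [starts_decision]
  split_ifs <;> omega

end SplitState

lemma State.mem_allowed {s : State} {u : Decision} (h_queue : ∑ d, u.starts d ≤ s.Q)
    (h_idle : ∀ d, u.starts d = 1 → s.residual d = 0) : u ∈ s.allowed := by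
  have h_loc := h_idle .loc
  have h_mec := h_idle .mec
  rw [Device.sum_eq] at h_queue
  unfold State.allowed
  cases u <;>
    simp only [Decision.starts, State.residual, Decision.ul1, Decision.ul2, Decision.uc1,
      Decision.uc2, forall_const] at h_queue h_loc h_mec <;>
    split_ifs <;> first | (exfalso; omega) | simp

lemma SplitState.decision_mem_allowed (s : SplitState) : s.decision ∈ s.merge.allowed := by
  refine State.mem_allowed (Finset.sum_le_sum fun d _ => s.starts_decision_le d) fun d hd => ?_
  rw [starts_decision] at hd
  rw [residual_merge]
  by_contra h
  simp [h] at hd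

lemma Decision.measurable_task {N : ℕ} (u : Decision) (d : Device) :
    Measurable (u.task (N := N) d) := by
  unfold Decision.task
  split_ifs
  · exact (measurable_fst.comp measurable_snd).comp Slot.measurable_rest
  · exact measurable_fst.comp Slot.measurable_rest

namespace System

variable (sys : System) (p : I)

/-- One step of the system with separate queues. -/
def splitNext (s : SplitState) (x : Slot sys.N) : SplitState :=
  (fun d => s.1 d - s.decision.starts d + x.routed p d, (sys.next s.merge s.decision x).residual)

/-- The evolution of the system with separate queues. -/
def splitState (ω : sys.Path) : ℕ → SplitState
  | 0 => (0, 0)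
  | t + 1 => sys.splitNext p (splitState ω t) (ω t)

variable {sys p}

lemma merge_splitNext (s : SplitState) (x : Slot sys.N) :
    (sys.splitNext p s x).merge = sys.next s.merge s.decision x := by
  have h_queue : (sys.splitNext p s x).merge.Q = (sys.next s.merge s.decision x).Q := by
    rw [Q_next]
    simp only [splitNext, SplitState.merge]
    rw [Finset.sum_add_distrib, Slot.sum_routed,
      Finset.sum_tsub_distrib _ fun d _ => s.starts_decision_le d]
  calc (sys.splitNext p s x).merge = ⟨(sys.splitNext p s x).merge.Q,
        (sys.next s.merge s.decision x).Sl, (sys.next s.merge s.decision x).Sc⟩ := rfl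
    _ = _ := by rw [h_queue]

lemma state_eq_merge_splitState (ω : sys.Path) (t : ℕ) :
    sys.state (fun t ω => (sys.splitState p ω t).decision) ω t = (sys.splitState p ω t).merge := by
  induction t with
  | zero => rfl
  | succ t ih => rw [state, ih, splitState, merge_splitNext]

lemma measurable_splitNext :
    Measurable fun z : SplitState × Slot sys.N => sys.splitNext p z.1 z.2 := by
  refine measurable_from_prod_countable_right fun s => ?_
  refine .prodMk (measurable_pi_lambda _ fun d => (Slot.measurable_routed p d).const_add
    (s.1 d - s.decision.starts d)) (measurable_pi_lambda _ fun d => ?_)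
  simp only [residual_next]
  split_ifs
  · exact (measurable_from_top (f := fun h => sys.service d h - 1)).comp
      (s.decision.measurable_task d)
  · exact measurable_const

lemma measurable_splitState (t : ℕ) :
    Measurable[sys.past t] fun ω => sys.splitState p ω t := by
  induction t with
  | zero => exact measurable_const
  | succ t ih =>
    exact measurable_splitNext.comp
      ((ih.mono (sys.past_mono t.le_succ) le_rfl).prodMk (sys.measurable_eval t))

variable (sys p) in
/-- The policy that routes each arrival at random to one of the devices, which serve their own
queues. -/
def splitPolicy : sys.Policy where
  act t ω := (sys.splitState p ω t).decision
  measurable_act t := (Measurable.of_discrete (f := SplitState.decision)).comp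
    ((measurable_splitState t).mono (sys.past_le_info t) le_rfl)
  act_mem t ω := by
    rw [state_eq_merge_splitState]
    exact SplitState.decision_mem_allowed _

lemma Q_splitPolicy (t : ℕ) (ω : sys.Path) :
    (sys.splitPolicy p).Q t ω = ∑ d, (sys.splitState p ω t).1 d :=
  congrArg State.Q (state_eq_merge_splitState ω t)

lemma residual_splitPolicy (d : Device) (t : ℕ) (ω : sys.Path) :
    (sys.splitPolicy p).residual d t ω = (sys.splitState p ω t).2 d :=
  (congrArg (State.residual · d) (state_eq_merge_splitState ω t)).trans
    (SplitState.residual_merge _ d)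

lemma servedQueue_splitPolicy (d : Device) : ServedQueue sys.past sys.P (sys.serviceLaw d)
    (sys.routedLaw p d) ((sys.splitPolicy p).starts d)
    (fun t ω => sys.service d ((sys.splitPolicy p).task d t ω)) ((sys.splitPolicy p).residual d)
    (fun t ω => (sys.splitState p ω t).1 d) (fun t ω => (ω t).routed p d) where
  toServer := { (sys.splitPolicy p).server d with
    le := sys.past_le
    measurable_u := fun t => (Measurable.of_discrete
      (f := fun s : SplitState => s.decision.starts d)).comp (measurable_splitState t)
    measurable_S := (sys.splitPolicy p).measurable_residual d
    isFresh := fun t => (((sys.splitPolicy p).server d).isFresh t).mono (sys.past_le_info t) }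
  q_zero _ := rfl
  q_succ _ _ := rfl
  u_eq t ω := by
    rw [residual_splitPolicy]
    exact SplitState.starts_decision _ d
  measurable_q t := ((measurable_pi_apply d).comp measurable_fst).comp (measurable_splitState t)
  isFresh_arrivals t := (sys.isFresh_eval t).comp (Slot.measurable_routed p d)
  memLp_arrivals := sys.memLp_routedLaw p d
  one_le_service := (ae_map_iff measurable_from_top.aemeasurable .of_discrete).2
    (sys.ae_one_le_service d)

end System

namespace System

variable {sys : System} {p : I}

lemma startRate_splitPolicy_le (d : Device) (T : ℕ) :
    (sys.splitPolicy p).startRate d T ≤ sys.lam * share p d := by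
  rw [← integral_routedLaw]
  refine div_le_of_le_mul₀ (Nat.cast_nonneg _) ?_ ?_
  · exact integral_nonneg fun k => Nat.cast_nonneg k
  · exact ((servedQueue_splitPolicy d).sum_integral_u_le T).trans_eq (mul_comm _ _)

lemma avgData_splitPolicy_le : (sys.splitPolicy p).avgData ≤
    ENNReal.ofReal (∑ d, share p d * sys.meanTransmission d) := by
  refine ((sys.splitPolicy p).avgData_le_of_startRate_le (fun _ => tendsto_const_nhds)
    startRate_splitPolicy_le).trans_eq ?_
  simp only [mul_assoc]
  rw [← Finset.mul_sum, mul_div_cancel_left₀ _ sys.coe_lam_pos.ne']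

lemma integral_Q_splitPolicy (t : ℕ) : ∫ ω, ((sys.splitPolicy p).Q t ω : ℝ) ∂sys.P =
    ∑ d, ∫ ω, ((sys.splitState p ω t).1 d : ℝ) ∂sys.P := by
  simp only [Q_splitPolicy, Nat.cast_sum]
  exact integral_finsetSum _ fun d _ =>
    ((servedQueue_splitPolicy d).memLp_q t).integrable one_le_two

lemma splitPolicy_mem_feasible (h : ∀ d, sys.lam * share p d * sys.meanService d < 1) :
    sys.splitPolicy p ∈ sys.feasible := by
  have h_queue (d : Device) : ∃ C : ℝ, ∀ T : ℕ,
      ∑ t ∈ Finset.range T, ∫ ω, ((sys.splitState p ω t).1 d : ℝ) ∂sys.P ≤ C * T := by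
    refine (servedQueue_splitPolicy d).exists_sum_integral_q_le ?_
    rw [integral_routedLaw, integral_serviceLaw]
    exact h d
  choose C hC using h_queue
  refine Policy.mem_feasible_of_sum_integral_Q_le (C := ∑ d, C d) fun T => ?_
  simp only [integral_Q_splitPolicy]
  rw [Finset.sum_comm, Finset.sum_mul]
  exact Finset.sum_le_sum fun d _ => hC d T

lemma exists_load_lt_one (h : sys.lam < sys.capacity) :
    ∃ q : I, ∀ d, sys.lam * share q d * sys.meanService d < 1 := by
  have h_pos (d : Device) : 0 < 1 / sys.meanService d := one_div_pos.2 (sys.meanService_pos d)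
  have h_capacity : 0 < sys.capacity := sys.coe_lam_pos.trans h
  have h_sum : sys.capacity = 1 / sys.meanService .loc + 1 / sys.meanService .mec :=
    Device.sum_eq _
  have h_share (d : Device) : share (1 / sys.meanService .loc / sys.capacity) d =
      1 / sys.meanService d / sys.capacity := by
    cases d
    · rfl
    · rw [share, one_sub_div h_capacity.ne', ← eq_sub_of_add_eq' h_sum.symm]
  refine ⟨⟨_, div_nonneg (h_pos .loc).le h_capacity.le,
    (div_le_one h_capacity).2 (h_sum ▸ le_add_of_nonneg_right (h_pos .mec).le)⟩, fun d => ?_⟩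
  calc sys.lam * share (1 / sys.meanService .loc / sys.capacity) d * sys.meanService d
      = sys.lam / sys.capacity := by
        have := (sys.meanService_pos d).ne'
        rw [h_share]
        field_simp
    _ < 1 := (div_lt_one h_capacity).2 h

lemma optData_le {p : ℝ} (hp : p ∈ I) (h_lam : sys.lam < sys.capacity)
    (h_load : ∀ d, sys.lam * share p d * sys.meanService d ≤ 1) :
    sys.optData ≤ ENNReal.ofReal (∑ d, share p d * sys.meanTransmission d) := by
  obtain ⟨q, hq⟩ := exists_load_lt_one h_lam
  let mix (s : ℝ) : ℝ := (1 - s) * p + s * q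
  have h_mix : ∀ᶠ s in nhdsWithin 0 (Set.Ioi 0), sys.optData ≤
      ENNReal.ofReal (∑ d, share (mix s) d * sys.meanTransmission d) := by
    filter_upwards [Ioo_mem_nhdsGT one_pos] with s ⟨hs, hs_one⟩
    have h_mem : mix s ∈ I := convex_Icc (0 : ℝ) 1 hp q.2 (sub_nonneg.2 hs_one.le) hs.le (by ring)
    have h_feasible : sys.splitPolicy ⟨mix s, h_mem⟩ ∈ sys.feasible := by
      refine splitPolicy_mem_feasible fun d => ?_
      calc sys.lam * share (mix s) d * sys.meanService d
          = (1 - s) * (sys.lam * share p d * sys.meanService d) +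
            s * (sys.lam * share q d * sys.meanService d) := by
            rw [share_mix]
            ring
        _ < (1 - s) * 1 + s * 1 := add_lt_add_of_le_of_lt
            (mul_le_mul_of_nonneg_left (h_load d) (sub_nonneg.2 hs_one.le))
            (mul_lt_mul_of_pos_left (hq d) hs)
        _ = 1 := by ring
    exact (iInf₂_le _ h_feasible).trans avgData_splitPolicy_le
  have h_lim : Tendsto (fun s => ENNReal.ofReal (∑ d, share (mix s) d * sys.meanTransmission d))
      (nhdsWithin 0 (Set.Ioi 0))
      (nhds (ENNReal.ofReal (∑ d, share p d * sys.meanTransmission d))) := by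
    have h_cont : Continuous fun s => ∑ d, share (mix s) d * sys.meanTransmission d := by
      simp only [mix, share_mix]
      fun_prop
    refine tendsto_nhdsWithin_of_tendsto_nhds (ENNReal.tendsto_ofReal ?_)
    simpa [mix] using h_cont.tendsto 0
  exact ge_of_tendsto h_lim h_mix

lemma feasible_nonempty (h_lam : sys.lam < sys.capacity) : sys.feasible.Nonempty :=
  let ⟨_, hq⟩ := exists_load_lt_one h_lam
  ⟨_, splitPolicy_mem_feasible hq⟩

end System

namespace System

variable {sys : System}

lemma sum_share_mul_meanTransmission (p : ℝ) : ∑ d, share p d * sys.meanTransmission d =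
    sys.meanDct - p * (sys.meanDct - sys.meanDlt) :=
  calc ∑ d, share p d * sys.meanTransmission d
      = p * sys.meanDlt + (1 - p) * sys.meanDct := Device.sum_eq _
    _ = _ := by ring

lemma lam_lt_capacity_of_le (h : sys.lam ≤ 1 / sys.meanNl) : sys.lam < sys.capacity :=
  calc (sys.lam : ℝ) ≤ 1 / sys.meanNl := h
    _ < 1 / sys.meanNl + 1 / sys.meanNc :=
      lt_add_of_pos_right _ (one_div_pos.2 (sys.meanService_pos .mec))
    _ = sys.capacity := sys.capacity_eq.symm

lemma optData_le_meanDlt (h : sys.lam ≤ 1 / sys.meanNl) :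
    sys.optData ≤ ENNReal.ofReal sys.meanDlt := by
  have h_loc : 0 < sys.meanNl := sys.meanService_pos .loc
  refine (optData_le (p := 1) ⟨zero_le_one, le_rfl⟩ (lam_lt_capacity_of_le h)
    fun d => ?_).trans_eq ?_
  · cases d
    · rw [share, mul_one]
      exact (le_div_iff₀ h_loc).1 h
    · simp [share]
  · rw [sum_share_mul_meanTransmission, one_mul, sub_sub_cancel]

lemma optData_le_saturatedData (h : 1 / sys.meanNl ≤ sys.lam) (h_lam : sys.lam < sys.capacity) :
    sys.optData ≤ ENNReal.ofReal sys.saturatedData := by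
  have h_pos := sys.coe_lam_pos
  have h_loc : 0 < sys.meanNl := sys.meanService_pos .loc
  have h_mec : 0 < sys.meanNc := sys.meanService_pos .mec
  have h_share : (sys.lam : ℝ) * (1 / (sys.lam * sys.meanNl)) = 1 / sys.meanNl := by field_simp
  have h_mem : 1 / (sys.lam * sys.meanNl) ∈ I :=
    ⟨by positivity, (div_le_one (by positivity)).2 ((div_le_iff₀ h_loc).1 h)⟩
  refine (optData_le h_mem h_lam fun d => ?_).trans_eq ?_
  · cases d
    · exact (congrArg (· * sys.meanNl) h_share).trans_le (one_div_mul_cancel h_loc.ne').le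
    · rw [capacity_eq] at h_lam
      rw [share, mul_sub, h_share, mul_one]
      exact (le_div_iff₀ h_mec).1 (sub_le_iff_le_add'.2 h_lam.le)
  · rw [sum_share_mul_meanTransmission, saturatedData]

lemma optData_le_of_eq_capacity (h : sys.lam = sys.capacity) (h_ne : sys.feasible.Nonempty) :
    sys.optData ≤ ENNReal.ofReal sys.saturatedData :=
  let ⟨π, hπ⟩ := h_ne
  (iInf₂_le π hπ).trans (π.avgData_le_saturatedData h)

lemma meanDlt_le_optData : ENNReal.ofReal sys.meanDlt ≤ sys.optData :=
  le_iInf₂ fun _ => Policy.meanDlt_le_avgData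

lemma saturatedData_le_optData : ENNReal.ofReal sys.saturatedData ≤ sys.optData :=
  le_iInf₂ fun _ => Policy.saturatedData_le_avgData

lemma feasible_eq_empty_of_capacity_lt (h : sys.capacity < sys.lam) : sys.feasible = ∅ :=
  Set.eq_empty_of_forall_notMem fun _ hπ => h.not_ge (Policy.lam_le_capacity hπ)

end System

end MEC

end

theorem proposition1 (sys : MEC.System) :
    ((sys.lam : ℝ) ≤ 1 / sys.meanNl →
      sys.feasible.Nonempty ∧ sys.optData = ENNReal.ofReal sys.meanDlt) ∧
    (1 / sys.meanNl < (sys.lam : ℝ) → (sys.lam : ℝ) < 1 / sys.meanNl + 1 / sys.meanNc →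
      sys.feasible.Nonempty ∧
      sys.optData = ENNReal.ofReal
        (sys.meanDct - 1 / ((sys.lam : ℝ) * sys.meanNl) * (sys.meanDct - sys.meanDlt))) ∧
    ((sys.lam : ℝ) = 1 / sys.meanNl + 1 / sys.meanNc →
      (sys.feasible.Nonempty → sys.optData = ENNReal.ofReal
        (sys.meanDct - 1 / ((sys.lam : ℝ) * sys.meanNl) * (sys.meanDct - sys.meanDlt))) ∧
      ((sys.lam : ℝ) < 1 → sys.feasible = ∅)) ∧
    (1 / sys.meanNl + 1 / sys.meanNc < (sys.lam : ℝ) → sys.feasible = ∅) := by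
  rw [← MEC.System.capacity_eq]
  refine ⟨fun h => ⟨?_, ?_⟩, fun h h_lam => ⟨?_, ?_⟩, fun h => ⟨fun h_ne => ?_, fun h_lam => ?_⟩,
    fun h => ?_⟩
  · exact MEC.System.feasible_nonempty (MEC.System.lam_lt_capacity_of_le h)
  · exact (MEC.System.optData_le_meanDlt h).antisymm MEC.System.meanDlt_le_optData
  · exact MEC.System.feasible_nonempty h_lam
  · exact (MEC.System.optData_le_saturatedData h.le h_lam).antisymm
      MEC.System.saturatedData_le_optData
  · exact (MEC.System.optData_le_of_eq_capacity h h_ne).antisymm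
      MEC.System.saturatedData_le_optData
  · exact MEC.System.feasible_eq_empty_of_capacity_le h.ge h_lam
  · exact MEC.System.feasible_eq_empty_of_capacity_lt h
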